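/- **Setting.** For an extended real-valued function $h$ on a finite-dimensional real Hilbert space $\mathcal K$ and a point $x$ with $h(x)$ finite, let $\widehat\partial h(x)$ be the set of $u$ with $\liminf_{z\to x}\frac{h(z)-h(x)-\langle u,z-x\rangle}{\|z-x\|}\ge 0$ and let $\partial_L h(x)$ (limiting subdifferential) be the set of limits of $u_n\in\widehat\partial h(x_n)$ with $x_n\to x$, $h(x_n)\to h(x)$; both are empty where $h$ is not finite. For $\alpha\in[0,1)$, $h$ has the KL property at $\bar x$ with exponent $\alpha$ if $\partial_L h(\bar x)\ne\varnothing$ and there are $\gamma>0$, $\eta\in(0,+\infty]$ and a neighbourhood $U$ of $\bar x$ such that, with $\varphi(s)=\gamma s^{1-\alpha}$, $\varphi'(h(x)-h(\bar x))\,\mathrm{dist}(0,\partial_L h(x))\ge 1$ for all $x\in U$ with $h(\bar x)<h(x)<h(\bar x)+\eta$ (where $\mathrm{dist}(0,\varnothing)=+\infty$). Let $\iota_S$ be $0$ on $S$ and $+\infty$ off $S$, let $\operatorname{dom} f=\{f<+\infty\}$, and let $f/g:=+\infty$ where $f=+\infty$. **Problems.** On $\mathbb R^N$ with the Euclidean norm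 consider $\min_{x\in S} f(x)/g(x)$ in one of the cases: (i) $f(x)=x^\top Ax+\iota_{\{\|x\|=1\}}(x)$, $g(x)=x^\top Bx$, $S=\mathbb R^N$, with $A,B$ symmetric positive definite; (ii) $f(x)=\|x\|_1$, $g(x)=\|x\|_2$, $S=\{x: Ax\le b,\ Cx=d\}$ for arbitrary real matrices $A,C$ and vectors $b,d$ of compatible sizes, with $0\notin S$. **Algorithm (e-PSG).** Let $f=f^{s}+f^{n}$ with $f^s$ convex, continuously differentiable, $\nabla f^s$ Lipschitz with modulus $\ell\ge0$, and $f^n$ proper and lower semicontinuous; let $\beta\ge 0$ be a weak convexity modulus of $g$ (here $g$ is convex, so every $\beta\ge0$ is allowed). Let (BC) with constants $m,M>0$ mean that $m\le g\le M$ on $S\cap\operatorname{dom} f$. Choose $\delta,\zeta>0$ with $1-\sqrt\beta\zeta>0$. If (BC) holds with $m,M$, let $\bar\mu\in\Big[0,\frac{\delta(1-\sqrt\beta\zeta)\sqrt{mM}}{2M}\Big)$ and $\bar\kappa\in\Big[0,\sqrt{\frac{m\delta(1-\sqrt\beta\zeta)}{\ell M}-\frac{2m\bar\mu}{\ell\sqrt{mM}}}\Big)$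 (upper bound $+\infty$ if $\ell=0$) and $c_*:=\frac{\ell\bar\kappa^2}{2m}+\frac{\bar\mu}{2\sqrt{mM}}$; if (BC) holds for no $m,M$, let $\bar\mu=\bar\kappa=c_*=0$. Start with $x_{-1}=x_0\in S\cap\operatorname{dom} f$ and, for $n\ge0$, put $\theta_n=f(x_n)/g(x_n)$, take $g_n\in\partial_L g(x_n)$, $0<\tau_n\le 1/\max\{\sqrt\beta\theta_n/\zeta,\delta\}$, $\kappa_n\in[0,\bar\kappa]$, $\mu_n\in[0,\bar\mu\tau_n]$, $u_n=x_n+\kappa_n(x_n-x_{n-1})$, $v_n=x_n+\mu_n(x_n-x_{n-1})$, and $$x_{n+1}\in\operatorname*{argmin}_{x\in S}\Big(f^n(x)+f^s(u_n)+\langle\nabla f^s(u_n),x-u_n\rangle+\tfrac1{2\tau_n}\|x-v_n-\tau_n\theta_ng_n\|^2+\tfrac{\ell}{2}\|x-u_n\|^2\Big).$$ **Proposition.** In each of the cases (i), (ii): (a) For every $c\ge 0$, the function $h_c(x,y)=\frac{f(x)}{g(x)}+\iota_S(x)+c\|x-y\|^2$ on $\mathbb R^N\times\mathbb R^N$ has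 the KL property with exponent $1/2$ at $(\bar x,\bar x)$ for every $\bar x\in S\cap\operatorname{dom} f$. (b) Let $(x_n)$ be any sequence generated by e-PSG such that $\{x\in S: f(x)/g(x)\le f(x_0)/g(x_0)\}$ is bounded and $\liminf_{n\to\infty}\tau_n>0$. Then $x_n\in S\cap\operatorname{dom} f$ for all $n$, and there are a stationary point $x_\infty\in S\cap\operatorname{dom} f$ (that is, $0\in\partial_L(\frac fg+\iota_S)(x_\infty)$), $\gamma_1,\gamma_2>0$ and $\rho\in(0,1)$ such that, for all $n\in\mathbb N$, $$|h_{c_*}(x_{n+1},x_n)-h_{c_*}(x_\infty,x_\infty)|\le\gamma_1\rho^n\quad\text{and}\quad\|x_n-x_\infty\|\le\gamma_2\rho^{n/2}.$$ -/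

import Mathlib

open Filter Topology Set
open scoped NNReal ENNReal Matrix

noncomputable section FractionalProgramming

section Subdifferentials

variable {E : Type*} [NormedAddCommGroup E] [InnerProductSpace ℝ E]

/-- The indicator function `ι_S` of a set: `0` on `S` and `+∞` outside `S`. -/
def indicatorTop (S : Set E) (x : E) : EReal :=
  open Classical in if x ∈ S then 0 else ⊤

/-- The Fréchet subdifferential of an extended real-valued function at `x`. It is empty unless
`h x` is finite; otherwise `u` belongs to it iff
`liminf_{z → x} (h z - h x - ⟪u, z - x⟫) / ‖z - x‖ ≥ 0`, that is, for every `ε > 0`, the inequality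
`h z ≥ h x + ⟪u, z - x⟫ - ε ‖z - x‖` holds for all `z` near `x`. -/
def frechetSubdiff (h : E → EReal) (x : E) : Set E :=
  {u | h x ≠ ⊤ ∧ h x ≠ ⊥ ∧ ∀ ε : ℝ, 0 < ε → ∀ᶠ z in 𝓝 x,
    (((h x).toReal + inner ℝ u (z - x) - ε * ‖z - x‖ : ℝ) : EReal) ≤ h z}

/-- The limiting subdifferential of `h` at `x` (empty unless `h x` is finite): limits of Fréchet
subgradients `u n` at points `y n` with `y n → x` and `h (y n) → h x`. -/
def limitingSubdiff (h : E → EReal) (x : E) : Set E :=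
  {u | h x ≠ ⊤ ∧ h x ≠ ⊥ ∧ ∃ (y v : ℕ → E),
    Tendsto y atTop (𝓝 x) ∧ Tendsto (fun n => h (y n)) atTop (𝓝 (h x)) ∧
    Tendsto v atTop (𝓝 u) ∧ ∀ n, v n ∈ frechetSubdiff h (y n)}

/-- `h` has the Kurdyka–Łojasiewicz property at `x` with an exponent of `α ∈ [0, 1)`: the point `x`
is in the domain of the limiting subdifferential, and for some `γ > 0`, `η ∈ (0, +∞]` and
`φ s = γ * s ^ (1 - α)`, the inequality `φ' (h z - h x) * dist (0, ∂_L h z) ≥ 1` holds for all `z`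
near `x` with `h x < h z < h x + η`. Here `φ' s = γ * (1 - α) * s ^ (-α)` is written out, and the
distance to the empty set is `+∞`. -/
def HasKLExponentAt (h : E → EReal) (x : E) (α : ℝ) : Prop :=
  (limitingSubdiff h x).Nonempty ∧ 0 ≤ α ∧ α < 1 ∧
    ∃ γ : ℝ, 0 < γ ∧ ∃ η : EReal, 0 < η ∧ ∀ᶠ z in 𝓝 x, h x < h z → h z < h x + η →
      1 ≤ ENNReal.ofReal (γ * (1 - α) * (h z - h x).toReal ^ (-α)) *
        Metric.infEDist 0 (limitingSubdiff h z)

end Subdifferentials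

section FractionalProgram

variable {E : Type*} [NormedAddCommGroup E] [InnerProductSpace ℝ E]

/-- The quotient `f / g` of an extended real-valued numerator and a real-valued denominator, with
the convention that it is `+∞` wherever `f` is (also where `g` vanishes). -/
def fracQuotient (f : E → EReal) (g : E → ℝ) (x : E) : EReal :=
  open Classical in if f x = ⊤ then ⊤ else f x / (g x : EReal)

/-- The objective function `F = f / g + ι_S`. -/
def fracObjective (f : E → EReal) (g : E → ℝ) (S : Set E) (x : E) : EReal :=
  fracQuotient f g x + indicatorTop S x

/-- The merit function `h (x, y) = f x / g x + ι_S x + c ‖x - y‖²` on the Hilbert space `E × E`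
(with its Euclidean product norm). -/
def meritFunction (f : E → EReal) (g : E → ℝ) (S : Set E) (c : ℝ) (z : WithLp 2 (E × E)) : EReal :=
  fracObjective f g S z.fst + ((c * ‖z.fst - z.snd‖ ^ 2 : ℝ) : EReal)

/-- `x` is a (limiting) stationary point of the problem of minimizing `f / g` over `S`. -/
def IsStationaryPoint (f : E → EReal) (g : E → ℝ) (S : Set E) (x : E) : Prop :=
  x ∈ S ∧ 0 ∈ limitingSubdiff (fracObjective f g S) x

end FractionalProgram

section Algorithm

variable {E : Type*} [NormedAddCommGroup E] [InnerProductSpace ℝ E]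

/-- An admissible splitting `f = fs + fn` of the numerator: `fs` is a continuously differentiable
convex function whose gradient is Lipschitz continuous with modulus `ℓ`, and `fn` is a proper lower
semicontinuous function. -/
structure IsNumeratorSplitting [CompleteSpace E] (f : E → EReal) (fs : E → ℝ) (fn : E → EReal)
    (ℓ : ℝ≥0) : Prop where
  eq_add : ∀ x, f x = (fs x : EReal) + fn x
  convex : ConvexOn ℝ univ fs
  contDiff : ContDiff ℝ 1 fs
  lipschitz : LipschitzWith ℓ (gradient fs)
  ne_bot : ∀ x, fn x ≠ ⊥
  exists_ne_top : ∃ x, fn x ≠ ⊤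
  lsc : LowerSemicontinuous fn

/-- The boundedness condition (BC) with constants `m, M > 0`: `m ≤ g x ≤ M` for all `x` in
`S ∩ dom f`. -/
def BoundednessCondition (f : E → EReal) (g : E → ℝ) (S : Set E) (m M : ℝ) : Prop :=
  0 < m ∧ 0 < M ∧ ∀ x ∈ S, f x ≠ ⊤ → m ≤ g x ∧ g x ≤ M

/-- The constants of the extrapolated proximal subgradient algorithm: the Lipschitz modulus `ℓ` of
the gradient of the smooth part of the numerator, the weak convexity modulus `β` of the denominator,
the constants `m, M` of (BC), and the algorithmic parameters `δ`, `ζ`, `μbar`, `κbar`. -/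
structure EPSGParams where
  ℓ : ℝ≥0
  β : ℝ
  m : ℝ
  M : ℝ
  δ : ℝ
  ζ : ℝ
  μbar : ℝ
  κbar : ℝ

/-- The requirements on the constants. If (BC) holds with constants `m, M`, then
`μbar ∈ [0, δ (1 - √β ζ) √(m M) / (2 M))` and
`κbar ∈ [0, √(m δ (1 - √β ζ) / (ℓ M) - 2 m μbar / (ℓ √(m M))))`, the latter bound being read as
`+∞` if `ℓ = 0`. In the absence of (BC), `μbar = κbar = 0`, and `m, M` play no role. -/
structure EPSGParams.Admissible (p : EPSGParams) (f : E → EReal) (g : E → ℝ) (S : Set E) :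
    Prop where
  β_nonneg : 0 ≤ p.β
  δ_pos : 0 < p.δ
  ζ_pos : 0 < p.ζ
  one_sub_pos : 0 < 1 - √p.β * p.ζ
  extrapolation :
    (BoundednessCondition f g S p.m p.M ∧
      0 ≤ p.μbar ∧ p.μbar < p.δ * (1 - √p.β * p.ζ) * √(p.m * p.M) / (2 * p.M) ∧
      0 ≤ p.κbar ∧ (0 < p.ℓ → p.κbar < √(p.m * p.δ * (1 - √p.β * p.ζ) / (p.ℓ * p.M)
        - 2 * p.m * p.μbar / (p.ℓ * √(p.m * p.M))))) ∨
    ((¬ ∃ m M : ℝ, BoundednessCondition f g S m M) ∧ p.μbar = 0 ∧ p.κbar = 0)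

/-- The constant of the merit function attached to the algorithm,
`c = ℓ κbar² / (2 m) + μbar / (2 √(m M))`. In the absence of (BC) one has `μbar = κbar = 0`, and the
formula returns `c = 0`, as it should. -/
def EPSGParams.meritConst (p : EPSGParams) : ℝ :=
  p.ℓ * p.κbar ^ 2 / (2 * p.m) + p.μbar / (2 * √(p.m * p.M))

/-- The function minimized over `S` in one step of the algorithm, for the step size `τ`, the current
value `θ` of the objective, the subgradient `w` of `g`, and the extrapolated points `u, v`. -/
def epsgSubproblem [CompleteSpace E] (fs : E → ℝ) (fn : E → EReal) (ℓ : ℝ≥0) (τ θ : ℝ) (w u v : E)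
    (y : E) : EReal :=
  fn y + ((fs u + inner ℝ (gradient fs u) (y - u) + 1 / (2 * τ) * ‖y - v - (τ * θ) • w‖ ^ 2
    + ℓ / 2 * ‖y - u‖ ^ 2 : ℝ) : EReal)

/-- `x` is a sequence generated by the extrapolated proximal subgradient algorithm (e-PSG) with
subgradients `w n ∈ ∂_L g (x n)`, step sizes `τ n` and extrapolation parameters `κ n`, `μ n`.
The truncated subtraction in `x (n - 1)` encodes the convention `x_{-1} = x_0`. -/
structure IsEPSGSequence [CompleteSpace E] (f : E → EReal) (fs : E → ℝ) (fn : E → EReal) (g : E → ℝ)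
    (S : Set E) (p : EPSGParams) (x w : ℕ → E) (τ κ μ : ℕ → ℝ) : Prop where
  init_mem : x 0 ∈ S
  init_dom : f (x 0) ≠ ⊤
  subgrad : ∀ n, w n ∈ limitingSubdiff (fun y => (g y : EReal)) (x n)
  τ_pos : ∀ n, 0 < τ n
  τ_le : ∀ n, τ n ≤ 1 / max (√p.β * (fracQuotient f g (x n)).toReal / p.ζ) p.δ
  κ_mem : ∀ n, κ n ∈ Icc 0 p.κbar
  μ_mem : ∀ n, μ n ∈ Icc 0 (p.μbar * τ n)
  step_mem : ∀ n, x (n + 1) ∈ S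
  step_isMinOn : ∀ n, IsMinOn
    (epsgSubproblem fs fn p.ℓ (τ n) (fracQuotient f g (x n)).toReal (w n)
      (x n + κ n • (x n - x (n - 1))) (x n + μ n • (x n - x (n - 1)))) S (x (n + 1))

end Algorithm

section Problems

variable {N : ℕ}

/-- The quadratic form `xᵀ A x`. -/
def quadForm (A : Matrix (Fin N) (Fin N) ℝ) (x : EuclideanSpace ℝ (Fin N)) : ℝ :=
  x.ofLp ⬝ᵥ (A *ᵥ x.ofLp)

/-- Rayleigh quotient optimization with spherical constraint: `f x = xᵀ A x + ι_C x` with `C` the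
unit sphere, `g x = xᵀ B x` and `S = ℝᴺ`, for symmetric positive definite matrices `A` and `B`. -/
def IsRayleighProblem (f : EuclideanSpace ℝ (Fin N) → EReal) (g : EuclideanSpace ℝ (Fin N) → ℝ)
    (S : Set (EuclideanSpace ℝ (Fin N))) : Prop :=
  ∃ A B : Matrix (Fin N) (Fin N) ℝ, A.PosDef ∧ B.PosDef ∧
    (∀ x, f x = (quadForm A x : EReal) + indicatorTop {y | ‖y‖ = 1} x) ∧
    (∀ x, g x = quadForm B x) ∧ S = univ

/-- Scale invariant sparse signal recovery: `f x = ‖x‖₁`, `g x = ‖x‖₂` and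
`S = {x | A x ≤ b, C x = d}`, where the denominator is positive on `S`, that is, `0 ∉ S`. -/
def IsSparseRecoveryProblem (f : EuclideanSpace ℝ (Fin N) → EReal)
    (g : EuclideanSpace ℝ (Fin N) → ℝ) (S : Set (EuclideanSpace ℝ (Fin N))) : Prop :=
  ∃ (K P : ℕ) (A : Matrix (Fin K) (Fin N) ℝ) (b : Fin K → ℝ)
    (C : Matrix (Fin P) (Fin N) ℝ) (d : Fin P → ℝ),
    (∀ x, f x = ((∑ i, |x i| : ℝ) : EReal)) ∧ (∀ x, g x = ‖x‖) ∧
    S = {x | (∀ i, (A *ᵥ x.ofLp) i ≤ b i) ∧ C *ᵥ x.ofLp = d} ∧ 0 ∉ S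

end Problems

end FractionalProgramming

/-! ### Fréchet and limiting subgradients -/

section FrechetCalculus

variable {E : Type*} [NormedAddCommGroup E] [InnerProductSpace ℝ E]

/-! Everything rests on one Łojasiewicz inequality for the objective F = f/g + ι_S: near each
feasible z, F(y) - F(z) ≤ γ‖u‖² for every Fréchet subgradient u at a feasible y whose value is not
much larger than F(z). `IsTameFraction` packages it with mild regularity; both problems satisfy it,
and (a) and (b) follow from it.

The inequality comes from quadratic forms, which are dominated by the squared norm of their gradient
(`LinearMap.IsSymmetric.exists_inner_le_norm_sq`). Put θ = F(z) and r = F(y). For the Rayleigh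
quotient, the form of A - θB takes the value (r - θ)g(y) at y. For ‖·‖₁/‖·‖₂, with σ the sign vector
of y, the form ⟨σ, ·⟩² - θ²‖·‖² takes the value (r² - θ²)‖y‖² at y. In both cases the gradient of
the form is, along the directions in which F is smooth, a multiple of u plus an error proportional
to the excess value; the square of that error is absorbed when the excess is small
(`exists_le_mul_sq_of_mul_le_sq`). The sparse problem works on one face at a time, and there are
finitely many faces.

For (a), the two components of a Fréchet subgradient of the merit function sum to a subgradient of
F, and the second component determines the penalty c‖x - y‖². So the inequality passes to the merit
function, and by a limit to limiting subgradients.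

For (b), write H_n for the merit value at (x_n, x_{n-1}) and h for its limit. The algorithm
decreases H_n by a multiple of ‖x_{n+1} - x_n‖², and optimality in the subproblem yields a
subgradient of F at x_{n+1} bounded by the last two displacements. With the Łojasiewicz inequality,
H_{n+2} - h ≤ K(H_n - H_{n+2}) eventually, hence geometric decay. The squared displacements inherit
it, so the sequence converges at the square root of that rate (`exists_linear_rate_of_descent`). -/

theorem mem_frechetSubdiff_of_minorant [CompleteSpace E] {F : E → EReal} {R : E → ℝ} {ρ x : E}
    (hR : HasGradientAt R ρ x) (hx : F x = R x) (hle : ∀ᶠ y in 𝓝 x, (R y : EReal) ≤ F y) :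
    ρ ∈ frechetSubdiff F x := by
  refine ⟨by simp [hx], by simp [hx], fun ε hε => ?_⟩
  have h := (hasGradientAt_iff_isLittleO.1 hR).def hε
  filter_upwards [h, hle] with y hy hy'
  refine le_trans ?_ hy'
  rw [hx, EReal.toReal_coe, EReal.coe_le_coe_iff]
  rw [Real.norm_eq_abs] at hy
  linarith [neg_abs_le (R y - R x - inner ℝ ρ (y - x))]

/-- Divide the Fréchet inequality along the curve by t and let t decrease to 0. The functions need
to agree only on the curve, so a subgradient of a constrained objective can be tested inside the
sphere or a polyhedral face. -/
theorem inner_le_of_frechetSubdiff_of_curve [CompleteSpace E] {F : E → EReal} {R : E → ℝ}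
    {ρ x u d : E} {z : ℝ → E} (hu : u ∈ frechetSubdiff F x) (hR : HasGradientAt R ρ x)
    (hz : HasDerivAt z d 0) (hz0 : z 0 = x) (hF : ∀ᶠ t in 𝓝 0, F (z t) = R (z t)) :
    inner ℝ u d ≤ inner ℝ ρ d := by
  obtain ⟨-, -, hu⟩ := hu
  have hFx : F x = R x := by simpa [hz0] using hF.self_of_nhds
  have hk : HasDerivAt (fun t => R (z t) - inner ℝ u (z t)) (inner ℝ ρ d - inner ℝ u d) 0 := by
    have h1 : HasDerivAt (fun t => R (z t)) (inner ℝ ρ d) 0 := by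
      have := (hasGradientAt_iff_hasFDerivAt.1 (hz0 ▸ hR)).comp_hasDerivAt (0 : ℝ) hz
      simpa [Function.comp_def] using this
    have h2 : HasDerivAt (fun t => inner ℝ u (z t)) (inner ℝ u d) 0 := by
      simpa [Function.comp_def] using (innerSL ℝ u).hasFDerivAt.comp_hasDerivAt (0 : ℝ) hz
    exact h1.sub h2
  have hs := hk.tendsto_slope.mono_left (nhdsWithin_mono (0 : ℝ) (s := Ioi 0) (by
    intro t ht; simpa using (ne_of_gt ht)))
  have hsz := (hz.tendsto_slope.mono_left (nhdsWithin_mono (0 : ℝ) (s := Ioi 0) (by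
    intro t ht; simpa using (ne_of_gt ht)))).norm
  have key : ∀ ε : ℝ, 0 < ε → 0 ≤ (inner ℝ ρ d - inner ℝ u d) + ε * ‖d‖ := by
    intro ε hε
    refine ge_of_tendsto (hs.add (hsz.const_mul ε)) ?_
    have hzc : Tendsto z (𝓝 0) (𝓝 x) := hz0 ▸ hz.continuousAt
    filter_upwards [self_mem_nhdsWithin, mem_nhdsWithin_of_mem_nhds (hzc.eventually (hu ε hε)),
      mem_nhdsWithin_of_mem_nhds hF] with t ht h1 h2
    have ht : 0 < t := ht
    rw [h2, hFx, EReal.toReal_coe, EReal.coe_le_coe_iff, inner_sub_right] at h1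
    simp only [slope_def_field, slope_def_module, sub_zero, hz0, norm_smul, norm_inv,
      Real.norm_eq_abs, abs_of_pos ht]
    have : 0 ≤ t⁻¹ * (R (z t) - inner ℝ u (z t) - (R x - inner ℝ u x) + ε * ‖z t - x‖) :=
      mul_nonneg (inv_nonneg.2 ht.le) (by linarith)
    rw [div_eq_inv_mul]
    linarith
  by_contra! h
  -- This ε makes the error ε‖d‖ at most half of the supposed gap; the `+ 1` covers d = 0.
  have h2 := key ((inner ℝ u d - inner ℝ ρ d) / (2 * (‖d‖ + 1))) (by
    apply div_pos <;> [linarith; positivity])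
  have h3 : (inner ℝ u d - inner ℝ ρ d) / (2 * (‖d‖ + 1)) * ‖d‖
      ≤ (inner ℝ u d - inner ℝ ρ d) / 2 := by
    rw [div_mul_eq_mul_div, div_le_div_iff₀ (by positivity) (by norm_num)]
    nlinarith [norm_nonneg d]
  linarith

theorem inner_eq_of_frechetSubdiff_of_curve [CompleteSpace E] {F : E → EReal} {R : E → ℝ}
    {ρ x u d : E} {z : ℝ → E} (hu : u ∈ frechetSubdiff F x) (hR : HasGradientAt R ρ x)
    (hz : HasDerivAt z d 0) (hz0 : z 0 = x) (hF : ∀ᶠ t in 𝓝 0, F (z t) = R (z t)) :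
    inner ℝ u d = inner ℝ ρ d := by
  refine le_antisymm (inner_le_of_frechetSubdiff_of_curve hu hR hz hz0 hF) ?_
  have hneg : HasDerivAt (fun t : ℝ => -t) (-1) 0 := hasDerivAt_neg 0
  have hz' : HasDerivAt (fun t => z (-t)) (-d) 0 := by
    have := HasDerivAt.scomp (0 : ℝ) (g₁ := z) (h := fun t : ℝ => -t) (by simpa using hz) hneg
    simpa [Function.comp_def] using this
  have := inner_le_of_frechetSubdiff_of_curve hu hR hz' (by simpa using hz0) (by
    have h0 : Tendsto (fun t : ℝ => -t) (𝓝 0) (𝓝 0) := by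
      simpa using (continuous_neg (G := ℝ)).tendsto 0
    exact h0.eventually hF)
  simpa using this

theorem frechetSubdiff_subset_limitingSubdiff (h : E → EReal) (x : E) :
    frechetSubdiff h x ⊆ limitingSubdiff h x := fun u hu =>
  ⟨hu.1, hu.2.1, fun _ => x, fun _ => u, tendsto_const_nhds, tendsto_const_nhds,
    tendsto_const_nhds, fun _ => hu⟩

/-- Convexity along the segment turns the local inequality at y + t(z - y), divided by t, into a
global one with arbitrarily small error. -/
theorem ConvexOn.le_of_mem_frechetSubdiff {g : E → ℝ} (hg : ConvexOn ℝ univ g) {y u : E}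
    (hu : u ∈ frechetSubdiff (fun x => (g x : EReal)) y) (z : E) :
    g y + inner ℝ u (z - y) ≤ g z := by
  obtain ⟨-, -, hu⟩ := hu
  refine le_of_forall_pos_le_add fun ε hε => ?_
  have h1 := hu (ε / (‖z - y‖ + 1)) (by positivity)
  have hc : Tendsto (fun t : ℝ => y + t • (z - y)) (𝓝[>] 0) (𝓝 y) := by
    have : Continuous fun t : ℝ => y + t • (z - y) := by fun_prop
    simpa using (this.tendsto 0).mono_left nhdsWithin_le_nhds
  obtain ⟨t, ht, ht0, ht1⟩ := ((hc.eventually h1).and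
    (Ioo_mem_nhdsGT (zero_lt_one (α := ℝ)))).exists
  simp only [EReal.toReal_coe, EReal.coe_le_coe_iff, add_sub_cancel_left, inner_smul_right,
    norm_smul, Real.norm_eq_abs, abs_of_pos ht0] at ht
  have h2 := hg.2 (mem_univ y) (mem_univ z) (by linarith : 0 ≤ 1 - t) ht0.le (by ring)
  have h3 : (1 - t) • y + t • z = y + t • (z - y) := by module
  rw [h3, smul_eq_mul, smul_eq_mul] at h2
  have h4 : ε / (‖z - y‖ + 1) * (t * ‖z - y‖) ≤ t * ε := by
    rw [div_mul_eq_mul_div, div_le_iff₀ (by positivity)]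
    nlinarith [mul_pos ht0 hε, norm_nonneg (z - y)]
  have h5 : t * (g y + inner ℝ u (z - y)) ≤ t * (g z + ε) := by linarith
  exact le_of_mul_le_mul_left h5 ht0

theorem ConvexOn.le_of_mem_limitingSubdiff {g : E → ℝ} (hg : ConvexOn ℝ univ g) {y u : E}
    (hu : u ∈ limitingSubdiff (fun x => (g x : EReal)) y) (z : E) :
    g y + inner ℝ u (z - y) ≤ g z := by
  obtain ⟨-, -, p, v, hp, hgp, hv, hpv⟩ := hu
  have hgp : Tendsto (fun n => g (p n)) atTop (𝓝 (g y)) := EReal.tendsto_coe.1 hgp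
  refine le_of_tendsto' (hgp.add (hv.inner (tendsto_const_nhds.sub hp))) fun n => ?_
  exact hg.le_of_mem_frechetSubdiff (hpv n) z

theorem ConvexOn.le_of_hasGradientAt [CompleteSpace E] {g : E → ℝ} (hg : ConvexOn ℝ univ g)
    {y u : E} (hu : HasGradientAt g u y) (z : E) : g y + inner ℝ u (z - y) ≤ g z :=
  hg.le_of_mem_frechetSubdiff
    (mem_frechetSubdiff_of_minorant hu rfl (Eventually.of_forall fun _ => le_rfl)) z

/-- A limiting subgradient of a convex function is a global affine minorant, hence a Fréchet
subgradient, and testing it on lines identifies it. This removes the freedom in the choice of the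
subgradients of the denominator. -/
theorem ConvexOn.eq_gradient_of_mem_limitingSubdiff [CompleteSpace E] {g : E → ℝ}
    (hg : ConvexOn ℝ univ g) {y u w : E} (hu : HasGradientAt g u y)
    (hw : w ∈ limitingSubdiff (fun x => (g x : EReal)) y) : w = u := by
  have hmem : w ∈ frechetSubdiff (fun x => (g x : EReal)) y := by
    refine ⟨by simp, by simp, fun ε hε => Eventually.of_forall fun z => ?_⟩
    have := hg.le_of_mem_limitingSubdiff hw z
    simp only [EReal.toReal_coe, EReal.coe_le_coe_iff]
    nlinarith [norm_nonneg (z - y)]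
  refine ext_inner_right ℝ fun d => ?_
  refine inner_eq_of_frechetSubdiff_of_curve (z := fun t => y + t • d) hmem hu ?_ (by simp)
    (Eventually.of_forall fun _ => rfl)
  simpa using ((hasDerivAt_id (0 : ℝ)).smul_const d).const_add y

/-- The descent lemma: the derivatives of the two sides are compared along the segment from x to y.
-/
theorem le_add_of_lipschitzWith_gradient [CompleteSpace E] {f : E → ℝ} {ℓ : ℝ≥0}
    (hf : Differentiable ℝ f) (hl : LipschitzWith ℓ (gradient f)) (x y : E) :
    f y ≤ f x + inner ℝ (gradient f x) (y - x) + ℓ / 2 * ‖y - x‖ ^ 2 := by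
  set d := y - x with hd
  have h1 : ∀ t : ℝ, HasDerivAt (fun t : ℝ => f (x + t • d)) (inner ℝ (gradient f (x + t • d)) d) t
      := by
    intro t
    have h2 : HasDerivAt (fun t : ℝ => x + t • d) d t := by
      simpa using ((hasDerivAt_id t).smul_const d).const_add x
    have := (hasGradientAt_iff_hasFDerivAt.1 (hf (x + t • d)).hasGradientAt).comp_hasDerivAt t h2
    simpa [Function.comp_def] using this
  have h2 : ∀ t : ℝ, HasDerivAt (fun t : ℝ => f x + t * inner ℝ (gradient f x) d
      + ℓ / 2 * t ^ 2 * ‖d‖ ^ 2) (inner ℝ (gradient f x) d + ℓ * t * ‖d‖ ^ 2) t := by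
    intro t
    have := (((hasDerivAt_id t).mul_const (inner ℝ (gradient f x) d)).const_add (f x)).add
      ((((hasDerivAt_id t).pow 2).const_mul (ℓ / 2 : ℝ)).mul_const (‖d‖ ^ 2))
    refine this.congr_deriv ?_
    simp only [id_eq, Nat.cast_ofNat, Nat.add_one_sub_one, pow_one]
    ring
  have := image_le_of_deriv_right_le_deriv_boundary (a := 0) (b := 1)
    (fun t _ => (h1 t).continuousAt.continuousWithinAt) (fun t _ => (h1 t).hasDerivWithinAt)
    (B := fun t : ℝ => f x + t * inner ℝ (gradient f x) d + ℓ / 2 * t ^ 2 * ‖d‖ ^ 2)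
    (by simp) (fun t _ => (h2 t).continuousAt.continuousWithinAt)
    (fun t _ => (h2 t).hasDerivWithinAt) (fun t ht => ?_) (x := 1) (by simp)
  · simpa [hd] using this
  · have h3 : inner ℝ (gradient f (x + t • d) - gradient f x) d ≤ ℓ * (t * ‖d‖) * ‖d‖ := by
      refine (real_inner_le_norm _ _).trans ?_
      gcongr
      have := hl.norm_sub_le (x + t • d) x
      simpa [norm_smul, abs_of_nonneg ht.1] using this
    rw [inner_sub_left] at h3
    nlinarith

/-- A Łojasiewicz inequality for the Fréchet subgradients near a point yields the
Kurdyka–Łojasiewicz property with exponent `1 / 2`. -/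
theorem hasKLExponentAt_half_of_frechet {h : E → EReal} {x : E} {a C η : ℝ} (hx : h x = a)
    (hne : (frechetSubdiff h x).Nonempty) (hη : 0 < η)
    (hKL : ∀ᶠ z in 𝓝 x, ∀ b : ℝ, h z = b → a < b → b < a + η → ∀ u ∈ frechetSubdiff h z,
      b - a ≤ C * ‖u‖ ^ 2) :
    HasKLExponentAt h x (1 / 2) := by
  refine ⟨hne.mono (frechetSubdiff_subset_limitingSubdiff h x), by norm_num, by norm_num, ?_⟩
  set K := max C 1
  have hK : 0 < K := lt_max_of_lt_right one_pos
  have hsK : 0 < √K := Real.sqrt_pos.2 hK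
  -- With this constant φ'(s) = √K · s^(-1/2), the reciprocal of the lower bound √(s/K) for the
  -- distance.
  refine ⟨2 * √K, by positivity, (η : EReal), by exact_mod_cast hη, ?_⟩
  -- The inequality is needed on a neighbourhood of z, because limiting subgradients at z are limits
  -- of Fréchet subgradients at nearby points.
  filter_upwards [hKL.eventually_nhds] with z hz h1 h2
  rw [hx] at h1 h2 ⊢
  have hzt : h z ≠ ⊤ := ne_top_of_lt h2
  have hzb : h z ≠ ⊥ := ne_bot_of_gt h1
  lift h z to ℝ using ⟨hzt, hzb⟩ with b hb
  rw [EReal.coe_lt_coe_iff] at h1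
  rw [← EReal.coe_add, EReal.coe_lt_coe_iff] at h2
  rw [← EReal.coe_sub, EReal.toReal_coe]
  have hs : 0 < b - a := sub_pos.2 h1
  have hlim : ∀ u ∈ limitingSubdiff h z, b - a ≤ K * ‖u‖ ^ 2 := by
    rintro u ⟨-, -, y, v, hy, hhy, hv, hyv⟩
    rw [← hb] at hhy
    have e1 := hy.eventually hz
    have hreal : Tendsto (fun n => (h (y n)).toReal) atTop (𝓝 b) := by
      simpa [Function.comp_def] using
        (EReal.tendsto_toReal (EReal.coe_ne_top b) (EReal.coe_ne_bot b)).comp hhy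
    have e2 := hreal.eventually (lt_mem_nhds h1)
    have e3 := hreal.eventually (gt_mem_nhds h2)
    refine le_of_tendsto_of_tendsto (hreal.sub_const a) ((hv.norm.pow 2).const_mul K) ?_
    filter_upwards [e1, e2, e3] with n h1 h2 h3
    refine (h1 _ (EReal.coe_toReal (hyv n).1 (hyv n).2.1).symm h2 h3 _ (hyv n)).trans ?_
    gcongr
    exact le_max_left _ _
  have hdist : ENNReal.ofReal (√((b - a) / K)) ≤ Metric.infEDist 0 (limitingSubdiff h z) := by
    refine Metric.le_infEDist.2 fun u hu => ?_
    rw [edist_zero_left, ← enorm_eq_nnnorm, ← ofReal_norm]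
    refine ENNReal.ofReal_le_ofReal (Real.sqrt_le_iff.2 ⟨norm_nonneg _, ?_⟩)
    rw [div_le_iff₀ hK]
    linarith [hlim u hu]
  refine le_trans ?_ (mul_le_mul_right hdist _)
  rw [← ENNReal.ofReal_mul (by positivity), ← ENNReal.ofReal_one]
  refine ENNReal.ofReal_le_ofReal (le_of_eq ?_)
  rw [Real.rpow_neg hs.le, ← Real.sqrt_eq_rpow, Real.sqrt_div hs.le]
  have : √(b - a) ≠ 0 := (Real.sqrt_pos.2 hs).ne'
  field_simp
  norm_num

end FrechetCalculus

/-! ### Łojasiewicz inequality for quadratic forms -/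

section QuadraticLojasiewicz

variable {E : Type*} [NormedAddCommGroup E] [InnerProductSpace ℝ E] [FiniteDimensional ℝ E]

/-- A quadratic form is dominated by the square of its gradient. -/
theorem LinearMap.IsSymmetric.exists_inner_le_norm_sq {T : E →ₗ[ℝ] E} (hT : T.IsSymmetric) :
    ∃ γ : ℝ, 0 ≤ γ ∧ ∀ v, inner ℝ v (T v) ≤ γ * ‖T v‖ ^ 2 := by
  -- A linear section of T on its range extends to S with T S T = T; symmetry then gives ⟨v, Tv⟩ =
  -- ⟨Tv, S(Tv)⟩.
  obtain ⟨s, hs⟩ := T.rangeRestrict.exists_rightInverse_of_surjective T.range_rangeRestrict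
  obtain ⟨S, hS⟩ := s.exists_extend
  have hTS : ∀ v, T (S (T v)) = T v := by
    intro v
    have h1 : S (T v) = s (T.rangeRestrict v) := by rw [← hS]; rfl
    have h2 := congrArg Subtype.val (LinearMap.congr_fun hs (T.rangeRestrict v))
    rw [h1]
    exact h2
  refine ⟨‖S.toContinuousLinearMap‖, norm_nonneg _, fun v => ?_⟩
  calc inner ℝ v (T v) = inner ℝ v (T (S (T v))) := by rw [hTS]
    _ = inner ℝ (T v) (S.toContinuousLinearMap (T v)) := (hT v _).symm
    _ ≤ ‖T v‖ * ‖S.toContinuousLinearMap (T v)‖ := real_inner_le_norm _ _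
    _ ≤ ‖T v‖ * (‖S.toContinuousLinearMap‖ * ‖T v‖) := by
      gcongr; exact ContinuousLinearMap.le_opNorm _ _
    _ = _ := by ring

/-- Apply the unrestricted bound to the compression P M P, with P the orthogonal projection onto V:
the hypothesis on u says that P(Mv) = Pu. -/
theorem LinearMap.IsSymmetric.exists_inner_le_norm_sq_of_submodule {M : E →ₗ[ℝ] E}
    (hM : M.IsSymmetric) (V : Submodule ℝ E) :
    ∃ γ : ℝ, 0 ≤ γ ∧ ∀ v ∈ V, ∀ u, (∀ d ∈ V, inner ℝ (M v) d = inner ℝ u d) →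
      inner ℝ v (M v) ≤ γ * ‖u‖ ^ 2 := by
  set P : E →ₗ[ℝ] E := V.starProjection.toLinearMap with hP
  have hPs : ∀ a b, inner ℝ (P a) b = inner ℝ a (P b) := fun a b =>
    V.inner_starProjection_left_eq_right a b
  have hPV : ∀ v ∈ V, P v = v := fun v hv => V.starProjection_eq_self_iff.2 hv
  have hPm : ∀ v, P v ∈ V := fun v => V.starProjection_apply_mem v
  have hT : (P ∘ₗ M ∘ₗ P).IsSymmetric := by
    intro a b
    simp only [LinearMap.comp_apply]
    rw [hPs, hM, hPs]
  obtain ⟨γ, hγ, h⟩ := hT.exists_inner_le_norm_sq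
  refine ⟨γ, hγ, fun v hv u hu => ?_⟩
  have h1 := h v
  have h2 : P (M v) = P u := by
    refine ext_inner_right ℝ fun d => ?_
    rw [hPs, hPs, hu _ (hPm d)]
  simp only [LinearMap.comp_apply, hPV v hv] at h1
  rw [← hPs, hPV v hv, h2] at h1
  refine h1.trans ?_
  gcongr
  exact V.norm_starProjection_apply_le u

/-- The Łojasiewicz inequality with exponent `1 / 2`, along an affine subspace, for a quadratic form
near one of its zeros. -/
theorem LinearMap.IsSymmetric.eventually_inner_le_norm_sq {M : E →ₗ[ℝ] E} (hM : M.IsSymmetric)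
    (V : Submodule ℝ E) {p : E} (hp : inner ℝ p (M p) = 0) :
    ∃ γ : ℝ, 0 ≤ γ ∧ ∀ᶠ x in 𝓝 p, x - p ∈ V → ∀ u,
      (∀ d ∈ V, inner ℝ (M x) d = inner ℝ u d) → inner ℝ x (M x) ≤ γ * ‖u‖ ^ 2 := by
  have hMc : Continuous M := M.continuous_of_finiteDimensional
  -- If p is critical along V, the form at x equals the form at x - p ∈ V. Otherwise the gradient
  -- along V stays away from 0 near p while the form stays below 1.
  by_cases hcrit : ∀ d ∈ V, inner ℝ (M p) d = 0
  · obtain ⟨γ, hγ, h⟩ := hM.exists_inner_le_norm_sq_of_submodule V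
    refine ⟨γ, hγ, Eventually.of_forall fun x hx u hu => ?_⟩
    have h1 : inner ℝ x (M x) = inner ℝ (x - p) (M (x - p)) := by
      have e1 := hcrit _ hx
      have e2 : inner ℝ p (M x) = inner ℝ (M p) x := (hM p x).symm
      have e3 : inner ℝ x (M p) = inner ℝ (M p) x := real_inner_comm _ _
      rw [inner_sub_right, hM p p, hp] at e1
      simp only [map_sub, inner_sub_left, inner_sub_right]
      linarith
    rw [h1]
    refine h _ hx u fun d hd => ?_
    rw [map_sub, inner_sub_left, hcrit d hd, sub_zero, hu d hd]
  · push Not at hcrit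
    obtain ⟨d, hd, hne⟩ := hcrit
    set c := |inner ℝ (M p) d| / 2 with hc
    have hc0 : 0 < c := half_pos (abs_pos.2 hne)
    have hd0 : 0 < ‖d‖ := norm_pos_iff.2 fun h => hne (by simp [h])
    have e1 : ∀ᶠ x in 𝓝 p, c < |inner ℝ (M x) d| := by
      have : Continuous fun x => |inner ℝ (M x) d| := by fun_prop
      exact this.continuousAt.eventually (lt_mem_nhds (half_lt_self (abs_pos.2 hne)))
    have e2 : ∀ᶠ x in 𝓝 p, inner ℝ x (M x) < 1 := by
      have : Continuous fun x => inner ℝ x (M x) := by fun_prop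
      exact this.continuousAt.eventually (gt_mem_nhds (hp.trans_lt one_pos))
    refine ⟨(‖d‖ / c) ^ 2, by positivity, ?_⟩
    filter_upwards [e1, e2] with x h1 h2 _ u hu
    rw [hu d hd] at h1
    have h3 : c ≤ ‖d‖ * ‖u‖ := by
      rw [mul_comm]; exact h1.le.trans (abs_real_inner_le_norm u d)
    have h4 : 1 ≤ ‖d‖ / c * ‖u‖ := by rwa [div_mul_eq_mul_div, le_div_iff₀ hc0, one_mul]
    calc inner ℝ x (M x) ≤ 1 ^ 2 := by linarith
      _ ≤ (‖d‖ / c * ‖u‖) ^ 2 := by gcongr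
      _ = _ := by ring

end QuadraticLojasiewicz

/-! ### Bounded Lipschitz functions -/

section LipschitzOnCompacts

variable {E X : Type*} [NormedAddCommGroup E] [NormedAddCommGroup X]

/-- `f` is bounded and Lipschitz continuous on `Q`. -/
def IsBoundedLipschitzOn (f : E → X) (Q : Set E) : Prop :=
  ∃ C : ℝ, 0 ≤ C ∧ (∀ x ∈ Q, ‖f x‖ ≤ C) ∧ ∀ x ∈ Q, ∀ y ∈ Q, ‖f x - f y‖ ≤ C * ‖x - y‖

theorem IsBoundedLipschitzOn.smul [NormedSpace ℝ X] {a : E → ℝ} {f : E → X} {Q : Set E}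
    (ha : IsBoundedLipschitzOn a Q) (hf : IsBoundedLipschitzOn f Q) :
    IsBoundedLipschitzOn (fun x => a x • f x) Q := by
  obtain ⟨A, hA, ha1, ha2⟩ := ha
  obtain ⟨B, hB, hf1, hf2⟩ := hf
  refine ⟨A * B + 2 * (A * B), by positivity, fun x hx => ?_, fun x hx y hy => ?_⟩
  · rw [norm_smul]
    have := mul_le_mul (ha1 x hx) (hf1 x hx) (norm_nonneg _) hA
    nlinarith [mul_nonneg hA hB]
  · have h : a x • f x - a y • f y = (a x - a y) • f x + a y • (f x - f y) := by module
    rw [h]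
    refine (norm_add_le _ _).trans ?_
    rw [norm_smul, norm_smul]
    have h1 := mul_le_mul (ha2 x hx y hy) (hf1 x hx) (norm_nonneg _) (by positivity)
    have h2 := mul_le_mul (ha1 y hy) (hf2 x hx y hy) (norm_nonneg _) hA
    have h3 : 0 ≤ A * B * ‖x - y‖ := by positivity
    linarith

theorem IsBoundedLipschitzOn.inv {a : E → ℝ} {Q : Set E} (ha : IsBoundedLipschitzOn a Q)
    {r : ℝ} (hr : 0 < r) (hle : ∀ x ∈ Q, r ≤ a x) :
    IsBoundedLipschitzOn (fun x => (a x)⁻¹) Q := by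
  obtain ⟨A, hA, -, ha2⟩ := ha
  refine ⟨max r⁻¹ (A / (r * r)), by positivity, fun x hx => ?_, fun x hx y hy => ?_⟩
  · refine le_max_of_le_left ?_
    have := hle x hx
    rw [norm_inv, Real.norm_eq_abs, abs_of_pos (hr.trans_le this)]
    gcongr
  · have hx' := hle x hx
    have hy' := hle y hy
    have hx0 := hr.trans_le hx'
    have hy0 := hr.trans_le hy'
    have h : (a x)⁻¹ - (a y)⁻¹ = (a y - a x) / (a x * a y) := by field_simp
    rw [h, norm_div, norm_sub_rev, norm_mul, Real.norm_of_nonneg hx0.le,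
      Real.norm_of_nonneg hy0.le]
    calc ‖a x - a y‖ / (a x * a y) ≤ (A * ‖x - y‖) / (r * r) := by
          gcongr; exact ha2 x hx y hy
      _ = A / (r * r) * ‖x - y‖ := by ring
      _ ≤ _ := by gcongr; exact le_max_right _ _

theorem isBoundedLipschitzOn_of_lipschitz {f : E → X} {Q : Set E} (hQ : IsCompact Q) {C : ℝ}
    (hf : ∀ x y, ‖f x - f y‖ ≤ C * ‖x - y‖) : IsBoundedLipschitzOn f Q := by
  have hl : LipschitzWith C.toNNReal f := LipschitzWith.of_dist_le_mul fun x y => by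
    rw [dist_eq_norm, dist_eq_norm, Real.coe_toNNReal']
    exact (hf x y).trans (by gcongr; exact le_max_left _ _)
  obtain ⟨B, hB⟩ := hQ.exists_bound_of_continuousOn hl.continuous.continuousOn
  refine ⟨max (max B C) 0, le_max_right _ _,
    fun x hx => (hB x hx).trans ((le_max_left _ _).trans (le_max_left _ _)),
    fun x _ y _ => (hf x y).trans ?_⟩
  gcongr
  exact (le_max_right _ _).trans (le_max_left _ _)

end LipschitzOnCompacts

/-! ### Abstract linear convergence -/

section LinearRate

variable {E : Type*} [NormedAddCommGroup E]

/-- Solving the recursion gives r(n+2) ≤ (L/(1+L)) r(n), so the rate per step is ρ = √(L/(1+L)). The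
recursion spans two indices because subgradients are controlled by two successive displacements. -/
theorem exists_geometric_bound_of_two_step {r : ℕ → ℝ} (hr : Antitone r) (h0 : ∀ n, 0 ≤ r n)
    {K : ℝ} (h : ∀ᶠ n in atTop, r (n + 2) ≤ K * (r n - r (n + 2))) :
    ∃ C ρ : ℝ, 0 < C ∧ 0 < ρ ∧ ρ < 1 ∧ ∀ n, r n ≤ C * ρ ^ n := by
  obtain ⟨n₀, hn₀⟩ := eventually_atTop.1 h
  set L := max K 1 with hL
  have hL1 : 1 ≤ L := le_max_right _ _
  set ρ := √(L / (1 + L)) with hρ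
  have hρ0 : 0 < ρ := Real.sqrt_pos.2 (by positivity)
  have hρ2 : ρ ^ 2 = L / (1 + L) := Real.sq_sqrt (by positivity)
  have hρ1 : ρ < 1 := by
    rw [hρ, Real.sqrt_lt' one_pos, one_pow, div_lt_one (by positivity)]; linarith
  have hstep : ∀ n, n₀ ≤ n → r (n + 2) ≤ ρ ^ 2 * r n := by
    intro n hn
    have h1 := hn₀ n hn
    have h2 : r (n + 2) ≤ r n := hr (by omega)
    have h3 : K * (r n - r (n + 2)) ≤ L * (r n - r (n + 2)) := by
      have : K ≤ L := le_max_left _ _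
      gcongr
    rw [hρ2, div_mul_eq_mul_div, le_div_iff₀ (by positivity)]
    linarith
  -- The constant covers all indices up to n₀ + 1, before the recursion applies; adding 1 to `r 0`
  -- keeps it positive.
  refine ⟨(r 0 + 1) / ρ ^ (n₀ + 1), ρ, by have := h0 0; positivity, hρ0, hρ1, fun n => ?_⟩
  induction n using Nat.strong_induction_on with
  | _ n ih =>
    by_cases hn : n ≤ n₀ + 1
    · have h1 : r n ≤ r 0 := hr (Nat.zero_le n)
      have h2 : ρ ^ (n₀ + 1) ≤ ρ ^ n := pow_le_pow_of_le_one hρ0.le hρ1.le hn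
      rw [div_mul_eq_mul_div, le_div_iff₀ (by positivity)]
      have := h0 0
      have := h0 n
      calc r n * ρ ^ (n₀ + 1) ≤ (r 0 + 1) * ρ ^ n := by gcongr; linarith
        _ = _ := rfl
    · obtain ⟨k, rfl⟩ : ∃ k, n = k + 2 := ⟨n - 2, by omega⟩
      calc r (k + 2) ≤ ρ ^ 2 * r k := hstep k (by omega)
        _ ≤ ρ ^ 2 * ((r 0 + 1) / ρ ^ (n₀ + 1) * ρ ^ k) := by
          gcongr; exact ih k (by omega)
        _ = _ := by ring

/-- R-linear convergence of a descent sequence for `θ + c ‖x - x₋‖²` under a Łojasiewicz inequality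
with exponent `1 / 2` at every point of the closed set `D`. -/
theorem exists_linear_rate_of_descent {D : Set E} (hD : IsClosed D) [ProperSpace E] {θ : E → ℝ}
    (hθ : ContinuousOn θ D) {Sub : E → Set E} {x : ℕ → E} (hx : ∀ n, x n ∈ D)
    (hbdd : Bornology.IsBounded (range x)) (hθ0 : ∀ y ∈ D, 0 ≤ θ y)
    {c ε : ℝ} (hc : 0 ≤ c) (hε : 0 < ε)
    (hdesc : ∀ n, θ (x (n + 1)) + (c + ε) * ‖x (n + 1) - x n‖ ^ 2
      ≤ θ (x n) + c * ‖x n - x (n - 1)‖ ^ 2)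
    {C : ℝ} {ξ : ℕ → E} (hξ : ∀ n, ξ n ∈ Sub (x (n + 1)))
    (hξC : ∀ n, ‖ξ n‖ ≤ C * (‖x (n + 1) - x n‖ + ‖x n - x (n - 1)‖))
    (hKL : ∀ z ∈ D, ∃ γ η : ℝ, 0 < η ∧ ∀ᶠ y in 𝓝 z, y ∈ D → ∀ u ∈ Sub y,
      θ y - θ z < η → θ y - θ z ≤ γ * ‖u‖ ^ 2) :
    ∃ p ∈ D, Tendsto x atTop (𝓝 p) ∧ Tendsto ξ atTop (𝓝 0) ∧
      ∃ γ₁ γ₂ ρ : ℝ, 0 < γ₁ ∧ 0 < γ₂ ∧ 0 < ρ ∧ ρ < 1 ∧ ∀ n : ℕ,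
        |θ (x (n + 1)) + c * ‖x (n + 1) - x n‖ ^ 2 - θ p| ≤ γ₁ * ρ ^ n ∧
        ‖x n - p‖ ≤ γ₂ * ρ ^ ((n : ℝ) / 2) := by
  set a : ℕ → ℝ := fun n => ‖x (n + 1) - x n‖ with ha
  set H : ℕ → ℝ := fun n => θ (x n) + c * ‖x n - x (n - 1)‖ ^ 2 with hH
  have hHs : ∀ n, H (n + 1) + ε * a n ^ 2 ≤ H n := by
    intro n
    have := hdesc n
    simp only [hH, ha, Nat.add_sub_cancel]
    linarith
  have hHa : Antitone H := antitone_nat_of_succ_le fun n => by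
    have := hHs n
    have : 0 ≤ ε * a n ^ 2 := by positivity
    linarith
  have hH0 : ∀ n, 0 ≤ H n := fun n => add_nonneg (hθ0 _ (hx n)) (by positivity)
  have hbb : BddBelow (range H) := ⟨0, by rintro _ ⟨n, rfl⟩; exact hH0 n⟩
  set h := ⨅ n, H n with hh
  have hHt : Tendsto H atTop (𝓝 h) := tendsto_atTop_ciInf hHa hbb
  have hHge : ∀ n, h ≤ H n := fun n => ciInf_le hbb n
  have ha2 : ∀ n, a n ^ 2 ≤ (H n - H (n + 1)) / ε := by
    intro n; rw [le_div_iff₀ hε]; linarith [hHs n]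
  have ha2t : Tendsto (fun n => a n ^ 2) atTop (𝓝 0) := by
    refine squeeze_zero (fun n => by positivity) ha2 ?_
    simpa using (hHt.sub (hHt.comp (tendsto_add_atTop_nat 1))).div_const ε
  have hθt : Tendsto (fun n => θ (x (n + 1))) atTop (𝓝 h) := by
    have := (hHt.comp (tendsto_add_atTop_nat 1)).sub (ha2t.const_mul c)
    simpa [hH, ha, Function.comp_def] using this
  have hξ2 : ∀ n, ‖ξ (n + 1)‖ ^ 2 ≤ 2 * C ^ 2 * (a (n + 1) ^ 2 + a n ^ 2) := by
    intro n
    have h1 := hξC (n + 1)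
    simp only [Nat.add_sub_cancel] at h1
    have h2 : ‖ξ (n + 1)‖ ^ 2 ≤ (C * (a (n + 1) + a n)) ^ 2 := by gcongr
    nlinarith [mul_nonneg (sq_nonneg C) (sq_nonneg (a (n + 1) - a n))]
  have hξt : Tendsto ξ atTop (𝓝 0) := by
    rw [← tendsto_add_atTop_iff_nat 1, tendsto_zero_iff_norm_tendsto_zero]
    have h1 : Tendsto (fun n => ‖ξ (n + 1)‖ ^ 2) atTop (𝓝 0) := by
      refine squeeze_zero (fun n => by positivity) hξ2 ?_
      simpa using ((ha2t.comp (tendsto_add_atTop_nat 1)).add ha2t).const_mul (2 * C ^ 2)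
    simpa [Function.comp_def, Real.sqrt_sq (norm_nonneg _)] using
      (Real.continuous_sqrt.tendsto 0).comp h1
  have hQc : IsCompact (closure (range x)) := hbdd.isCompact_closure
  have hQD : closure (range x) ⊆ D := hD.closure_subset_iff.2 (by rintro _ ⟨n, rfl⟩; exact hx n)
  -- Convergence of x is not yet known, so a constant uniform over the compact closure of the orbit
  -- is obtained by compact induction. Near a point whose value is not h there is nothing to prove
  -- for large n, since the values along the orbit tend to h.
  have hloc : ∃ γ : ℝ, ∀ᶠ n in atTop, x (n + 1) ∈ closure (range x) →
      θ (x (n + 1)) - h ≤ γ * ‖ξ n‖ ^ 2 := by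
    refine hQc.induction_on (p := fun s => ∃ γ : ℝ, ∀ᶠ n in atTop, x (n + 1) ∈ s →
      θ (x (n + 1)) - h ≤ γ * ‖ξ n‖ ^ 2) ⟨0, by simp⟩ ?_ ?_ ?_
    · rintro s t hst ⟨γ, hγ⟩
      exact ⟨γ, hγ.mono fun n hn hs => hn (hst hs)⟩
    · rintro s t ⟨γ, hγ⟩ ⟨γ', hγ'⟩
      refine ⟨max γ γ', ?_⟩
      filter_upwards [hγ, hγ'] with n h1 h2 h3
      rcases h3 with h3 | h3
      · exact (h1 h3).trans (by gcongr; exact le_max_left _ _)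
      · exact (h2 h3).trans (by gcongr; exact le_max_right _ _)
    · intro z hz
      have hzD := hQD hz
      by_cases hzh : θ z = h
      · obtain ⟨γ, η, hη, hKLz⟩ := hKL z hzD
        refine ⟨_, mem_nhdsWithin_of_mem_nhds hKLz, γ, ?_⟩
        filter_upwards [hθt.eventually (gt_mem_nhds (show h < h + η by linarith))] with n h1 h2
        have := h2 (hx _) _ (hξ n)
        rw [hzh] at this
        exact this (by linarith)
      · have h1 : ∀ᶠ y in 𝓝[closure (range x)] z, |θ z - h| / 2 < |θ y - h| := by
          have : Tendsto (fun y => |θ y - h|) (𝓝[closure (range x)] z) (𝓝 |θ z - h|) :=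
            (((hθ z hzD).mono hQD).tendsto.sub_const h).abs
          exact this.eventually (lt_mem_nhds (half_lt_self (abs_pos.2 (sub_ne_zero.2 hzh))))
        refine ⟨_, h1, 0, ?_⟩
        have h2 : Tendsto (fun n => |θ (x (n + 1)) - h|) atTop (𝓝 0) := by
          simpa using (hθt.sub_const h).abs
        filter_upwards [h2.eventually (gt_mem_nhds
          (half_pos (abs_pos.2 (sub_ne_zero.2 hzh))))] with n h3 h4
        exact absurd h4 (not_lt.2 h3.le)
  obtain ⟨γ, hγ⟩ := hloc
  -- The value gap at x(n+2) is bounded by ‖ξ(n+1)‖², hence by the sum of two squared displacements,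
  -- which the descent telescopes into H(n) - H(n+2).
  have hstep : ∀ᶠ n in atTop, (H (n + 2) - h) ≤
      ((max γ 0 * (2 * C ^ 2) + c) / ε) * ((H n - h) - (H (n + 2) - h)) := by
    filter_upwards [(tendsto_add_atTop_nat 1).eventually hγ] with n hn
    have h1 := hn (subset_closure ⟨_, rfl⟩)
    have h2 : γ * ‖ξ (n + 1)‖ ^ 2 ≤ max γ 0 * (2 * C ^ 2 * (a (n + 1) ^ 2 + a n ^ 2)) := by
      have := hξ2 n
      have h3 : γ ≤ max γ 0 := le_max_left _ _
      calc γ * ‖ξ (n + 1)‖ ^ 2 ≤ max γ 0 * ‖ξ (n + 1)‖ ^ 2 := by gcongr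
        _ ≤ _ := by gcongr
    have h3 : H (n + 2) = θ (x (n + 1 + 1)) + c * a (n + 1) ^ 2 := by simp [hH, ha]
    have h4 : a (n + 1) ^ 2 + a n ^ 2 ≤ (H n - H (n + 2)) / ε := by
      have e1 := ha2 n
      have e2 := ha2 (n + 1)
      have e3 : (H n - H (n + 2)) / ε
          = (H n - H (n + 1)) / ε + (H (n + 1) - H (n + 1 + 1)) / ε := by ring
      linarith
    have h5 : 0 ≤ max γ 0 * (2 * C ^ 2) + c := by positivity
    have h6 : c * a (n + 1) ^ 2 ≤ c * (a (n + 1) ^ 2 + a n ^ 2) := by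
      gcongr; linarith [sq_nonneg (a n)]
    calc H (n + 2) - h ≤ (max γ 0 * (2 * C ^ 2) + c) * (a (n + 1) ^ 2 + a n ^ 2) := by
          linarith
      _ ≤ (max γ 0 * (2 * C ^ 2) + c) * ((H n - H (n + 2)) / ε) := by gcongr
      _ = _ := by ring
  obtain ⟨B, ρ, hB, hρ0, hρ1, hr⟩ := exists_geometric_bound_of_two_step
    (r := fun n => H n - h) (fun m n hmn => by have := hHa hmn; simp only; linarith)
    (fun n => sub_nonneg.2 (hHge n)) hstep
  -- The descent controls squared displacements, so the displacements themselves decay at the rate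
  -- √ρ.
  set σ := √ρ with hσ
  have hσ0 : 0 < σ := Real.sqrt_pos.2 hρ0
  have hσ1 : σ < 1 := by rw [hσ, Real.sqrt_lt' one_pos]; simpa using hρ1
  have hσn : ∀ n : ℕ, (σ ^ n) ^ 2 = ρ ^ n := by
    intro n; rw [← pow_mul, mul_comm, pow_mul, Real.sq_sqrt hρ0.le]
  have hdist : ∀ n, dist (x n) (x (n + 1)) ≤ √(B / ε) * σ ^ n := by
    intro n
    rw [dist_comm, dist_eq_norm]
    refine (sq_le_sq₀ (norm_nonneg _) (by positivity)).1 ?_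
    rw [mul_pow, hσn, Real.sq_sqrt (by positivity), div_mul_eq_mul_div]
    refine (ha2 n).trans ?_
    gcongr
    linarith [hr n, hHge (n + 1)]
  obtain ⟨p, hp⟩ := cauchySeq_tendsto_of_complete (cauchySeq_of_le_geometric _ _ hσ1 hdist)
  have hpD : p ∈ D := hD.mem_of_tendsto hp (Eventually.of_forall hx)
  have hθp : θ p = h := by
    refine tendsto_nhds_unique ?_ hθt
    have h1 : Tendsto (fun n => x (n + 1)) atTop (𝓝[D] p) :=
      tendsto_nhdsWithin_iff.2 ⟨hp.comp (tendsto_add_atTop_nat 1), Eventually.of_forall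
        fun n => hx _⟩
    exact (hθ p hpD).tendsto.comp h1
  refine ⟨p, hpD, hp, hξt, B * ρ, (√(B / ε) / (1 - σ)), ρ, by positivity,
    div_pos (by positivity) (by linarith), hρ0, hρ1, fun n => ⟨?_, ?_⟩⟩
  · have h1 := hr (n + 1)
    have h2 := hHge (n + 1)
    have h3 : H (n + 1) = θ (x (n + 1)) + c * ‖x (n + 1) - x n‖ ^ 2 := by simp [hH]
    rw [hθp, ← h3, abs_of_nonneg (by linarith)]
    calc H (n + 1) - h ≤ B * ρ ^ (n + 1) := h1
      _ = _ := by ring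
  · have h1 := dist_le_of_le_geometric_of_tendsto _ _ hσ1 hdist hp n
    rw [dist_eq_norm] at h1
    have h2 : ρ ^ ((n : ℝ) / 2) = σ ^ n := by
      rw [hσ, Real.sqrt_eq_rpow, ← Real.rpow_natCast, ← Real.rpow_mul hρ0.le]
      congr 1; ring
    rw [h2]
    calc _ ≤ _ := h1
      _ = _ := by ring

end LinearRate

/-! ### Real values of the objective and the merit function -/

section FracValue

variable {E : Type*}

/-- The effective feasible set `S ∩ dom f`. -/
def fracDom (f : E → EReal) (S : Set E) : Set E := {x | x ∈ S ∧ f x ≠ ⊤}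

/-- The real value of `f / g`. -/
noncomputable def fracValue (f : E → EReal) (g : E → ℝ) (x : E) : ℝ := (f x).toReal / g x

theorem fracQuotient_eq_coe {f : E → EReal} {x : E} (g : E → ℝ) (hb : f x ≠ ⊥) (ht : f x ≠ ⊤) :
    fracQuotient f g x = fracValue f g x := by
  rw [fracQuotient, if_neg ht, fracValue, EReal.coe_div, EReal.coe_toReal ht hb]

theorem fracObjective_eq_coe {f : E → EReal} {S : Set E} {x : E} (g : E → ℝ) (hb : f x ≠ ⊥)
    (hx : x ∈ fracDom f S) : fracObjective f g S x = fracValue f g x := by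
  rw [fracObjective, fracQuotient_eq_coe g hb hx.2, indicatorTop, if_pos hx.1, add_zero]

theorem fracObjective_eq_top {f : E → EReal} {S : Set E} {x : E} (g : E → ℝ) (hb : f x ≠ ⊥)
    (hx : x ∉ fracDom f S) : fracObjective f g S x = ⊤ := by
  have hq : fracQuotient f g x ≠ ⊥ := by
    by_cases ht : f x = ⊤
    · simp [fracQuotient, ht]
    · simp [fracQuotient_eq_coe g hb ht]
  by_cases hS : x ∈ S
  · have ht : f x = ⊤ := by
      by_contra ht
      exact hx ⟨hS, ht⟩
    simp [fracObjective, fracQuotient, ht, indicatorTop, hS]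
  · rw [fracObjective, indicatorTop, if_neg hS, EReal.add_top_of_ne_bot hq]

theorem meritFunction_eq_coe [NormedAddCommGroup E] {f : E → EReal} {g : E → ℝ} {S : Set E}
    {z : WithLp 2 (E × E)} (hb : ∀ x, f x ≠ ⊥) (c : ℝ)
    (hz : z.fst ∈ fracDom f S) :
    meritFunction f g S c z = ((fracValue f g z.fst + c * ‖z.fst - z.snd‖ ^ 2 : ℝ) : EReal) := by
  rw [meritFunction, fracObjective_eq_coe g (hb _) hz, EReal.coe_add]

theorem fst_mem_fracDom_of_meritFunction_eq_coe [NormedAddCommGroup E] {f : E → EReal}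
    {g : E → ℝ} {S : Set E} {z : WithLp 2 (E × E)} (hb : ∀ x, f x ≠ ⊥) {c b : ℝ}
    (hz : meritFunction f g S c z = b) : z.fst ∈ fracDom f S := by
  by_contra h
  rw [meritFunction, fracObjective_eq_top g (hb _) h, EReal.top_add_coe] at hz
  exact EReal.top_ne_coe _ hz

end FracValue

/-! ### Tame fractions and the KL property of the merit function -/

section TameFraction

variable {E : Type*} [NormedAddCommGroup E] [InnerProductSpace ℝ E]

theorem WithLp.toLp_zero_zero {E : Type*} [NormedAddCommGroup E] :
    WithLp.toLp 2 ((0 : E), (0 : E)) = 0 := rfl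

theorem HasGradientAt.fun_div [CompleteSpace E] {a b : E → ℝ} {p q x : E}
    (ha : HasGradientAt a p x) (hb : HasGradientAt b q x) (hx : b x ≠ 0) :
    HasGradientAt (fun y => a y / b y) ((b x)⁻¹ • (p - (a x / b x) • q)) x := by
  rw [hasGradientAt_iff_hasFDerivAt] at *
  have h := ha.mul ((hasDerivAt_inv hx).comp_hasFDerivAt x hb)
  refine h.congr_fderiv ?_
  ext d
  simp
  field_simp
  ring

/-- The regularity of a fractional program that the convergence analysis of e-PSG needs: the
denominator `g` is convex with gradient `G` on `S ∩ dom f`, the quotient and `G` are Lipschitz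
continuous on compact subsets, and the objective satisfies a Łojasiewicz inequality with exponent
`1 / 2` for its Fréchet subgradients near every feasible point. -/
structure IsTameFraction [CompleteSpace E] (f : E → EReal) (g : E → ℝ) (S : Set E) (G : E → E) :
    Prop where
  ne_bot : ∀ x, f x ≠ ⊥
  isClosed : IsClosed (fracDom f S)
  nonneg : ∀ x ∈ fracDom f S, 0 ≤ (f x).toReal
  pos : ∀ x ∈ fracDom f S, 0 < g x
  convexOn : ConvexOn ℝ univ g
  hasGradientAt : ∀ x ∈ fracDom f S, HasGradientAt g (G x) x
  continuousOn : ContinuousOn (fracValue f g) (fracDom f S)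
  lipschitz_value : ∀ Q ⊆ fracDom f S, IsCompact Q → IsBoundedLipschitzOn (fracValue f g) Q
  lipschitz_gradient : ∀ Q ⊆ fracDom f S, IsCompact Q → IsBoundedLipschitzOn G Q
  nonempty : ∀ z ∈ fracDom f S, (frechetSubdiff (fracObjective f g S) z).Nonempty
  lojasiewicz : ∀ z ∈ fracDom f S, ∃ γ η : ℝ, 0 < η ∧ ∀ᶠ y in 𝓝 z, y ∈ fracDom f S →
    ∀ u ∈ frechetSubdiff (fracObjective f g S) y, fracValue f g y - fracValue f g z < η →
      fracValue f g y - fracValue f g z ≤ γ * ‖u‖ ^ 2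

/-- Fréchet subgradients are transported along maps that are affine with respect to `w`. -/
theorem mem_frechetSubdiff_comp {E' : Type*} [NormedAddCommGroup E'] [InnerProductSpace ℝ E']
    {h : E' → EReal} {F : E → EReal} {k : E → E'} {x u : E} {w : E'} {r K : ℝ}
    (hw : w ∈ frechetSubdiff h (k x)) (hK : 0 < K) (hk : ∀ y, ‖k y - k x‖ ≤ K * ‖y - x‖)
    (hkc : ContinuousAt k x)
    (hi : ∀ y, inner ℝ w (k y - k x) = inner ℝ u (y - x)) (hF : ∀ y, h (k y) = F y + (r : EReal)) :
    u ∈ frechetSubdiff F x := by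
  obtain ⟨ht, hb, hw⟩ := hw
  have hFt : F x ≠ ⊤ := by
    intro h1; apply ht; rw [hF, h1]; rfl
  have hFb : F x ≠ ⊥ := by
    intro h1; apply hb; rw [hF, h1]; rfl
  refine ⟨hFt, hFb, fun ε hε => ?_⟩
  filter_upwards [hkc.eventually (hw (ε / K) (by positivity))] with y hy
  rw [hF y, hF x, EReal.toReal_add hFt hFb (EReal.coe_ne_top _) (EReal.coe_ne_bot _),
    EReal.toReal_coe, hi] at hy
  have h1 : ε / K * ‖k y - k x‖ ≤ ε * ‖y - x‖ := by
    rw [div_mul_eq_mul_div, div_le_iff₀ hK]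
    calc ε * ‖k y - k x‖ ≤ ε * (K * ‖y - x‖) := by gcongr; exact hk y
      _ = _ := by ring
  rcases eq_or_ne (F y) ⊤ with h2 | h2
  · rw [h2]; exact le_top
  rcases eq_or_ne (F y) ⊥ with h3 | h3
  · rw [h3] at hy
    exact absurd hy (by simp [-EReal.coe_add, -EReal.coe_sub])
  lift F y to ℝ using ⟨h2, h3⟩ with b
  rw [← EReal.coe_add, EReal.coe_le_coe_iff] at hy
  rw [EReal.coe_le_coe_iff]
  linarith

variable {f : E → EReal} {g : E → ℝ} {S : Set E} {G : E → E}

/-- Translations along the diagonal preserve x - y, so along them the merit function differs from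
the objective by a constant. -/
theorem fst_add_snd_mem_frechetSubdiff {c : ℝ} {z w : WithLp 2 (E × E)}
    (hw : w ∈ frechetSubdiff (meritFunction f g S c) z) :
    w.fst + w.snd ∈ frechetSubdiff (fracObjective f g S) z.fst := by
  refine mem_frechetSubdiff_comp (h := meritFunction f g S c) (w := w) (K := 2)
    (r := c * ‖z.fst - z.snd‖ ^ 2)
    (k := fun y => z + WithLp.toLp 2 (y - z.fst, y - z.fst)) ?_ two_pos ?_ ?_ ?_ ?_
  · simpa [WithLp.toLp_zero_zero] using hw
  · intro y
    have h1 := WithLp.prod_norm_sq_eq_of_L2 (WithLp.toLp 2 (y - z.fst, y - z.fst))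
    simp only [WithLp.toLp_fst, WithLp.toLp_snd] at h1
    have h2 : z + WithLp.toLp 2 (y - z.fst, y - z.fst)
        - (z + WithLp.toLp 2 (z.fst - z.fst, z.fst - z.fst))
        = WithLp.toLp 2 (y - z.fst, y - z.fst) := by
      simp
    simp only [h2]
    refine (sq_le_sq₀ (norm_nonneg _) (by positivity)).1 ?_
    rw [h1]
    nlinarith [sq_nonneg ‖y - z.fst‖]
  · have : Continuous fun y : E => z + WithLp.toLp 2 (y - z.fst, y - z.fst) :=
      continuous_const.add ((WithLp.prod_continuous_toLp 2 E E).comp (by fun_prop))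
    exact this.continuousAt
  · intro y
    simp [WithLp.prod_inner_apply, inner_add_left]
  · intro y
    have h1 : y - (z.snd + (y - z.fst)) = z.fst - z.snd := by abel
    simp [meritFunction, h1]

/-- With the first variable frozen at a feasible point, the merit function is a smooth quadratic in
the second. -/
theorem snd_eq_of_mem_frechetSubdiff [CompleteSpace E] {c : ℝ} {z w : WithLp 2 (E × E)}
    (hb : ∀ x, f x ≠ ⊥) (hz : z.fst ∈ fracDom f S)
    (hw : w ∈ frechetSubdiff (meritFunction f g S c) z) :
    w.snd = (2 * c) • (z.snd - z.fst) := by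
  have h1 : w.snd ∈ frechetSubdiff
      (fun y => ((fracValue f g z.fst + c * ‖y - z.fst‖ ^ 2 : ℝ) : EReal)) z.snd := by
    refine mem_frechetSubdiff_comp (h := meritFunction f g S c) (w := w) (K := 1) (r := 0)
      (k := fun y => z + WithLp.toLp 2 (0, y - z.snd)) ?_ one_pos ?_ ?_ ?_ ?_
    · simpa [WithLp.toLp_zero_zero] using hw
    · intro y
      simp [WithLp.toLp_zero_zero]
    · have : Continuous fun y : E => z + WithLp.toLp 2 ((0 : E), y - z.snd) :=
        continuous_const.add ((WithLp.prod_continuous_toLp 2 E E).comp (by fun_prop))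
      exact this.continuousAt
    · intro y
      simp [WithLp.prod_inner_apply]
    · intro y
      rw [meritFunction_eq_coe hb _ (by simpa using hz)]
      simp [norm_sub_rev]
  have h2 : HasGradientAt (fun y => fracValue f g z.fst + c * ‖y - z.fst‖ ^ 2)
      ((2 * c) • (z.snd - z.fst)) z.snd := by
    rw [hasGradientAt_iff_hasFDerivAt]
    have h3 := (((hasStrictFDerivAt_norm_sq (z.snd - z.fst)).hasFDerivAt.comp z.snd
      ((hasFDerivAt_id z.snd).sub_const z.fst)).const_mul c).const_add (fracValue f g z.fst)
    refine h3.congr_fderiv ?_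
    ext d
    simp
    ring
  refine ext_inner_right ℝ fun d => ?_
  refine inner_eq_of_frechetSubdiff_of_curve (z := fun t => z.snd + t • d) h1 h2 ?_ (by simp)
    (Eventually.of_forall fun _ => rfl)
  simpa using ((hasDerivAt_id (0 : ℝ)).smul_const d).const_add z.snd

theorem IsTameFraction.hasKLExponentAt [CompleteSpace E] (h : IsTameFraction f g S G) {c : ℝ}
    (hc : 0 ≤ c) {x : E}
    (hx : x ∈ fracDom f S) :
    HasKLExponentAt (meritFunction f g S c) (WithLp.toLp 2 (x, x)) (1 / 2) := by
  obtain ⟨γ, η, hη, hKL⟩ := h.lojasiewicz x hx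
  -- The factor 2 comes from ‖w₁ + w₂‖² ≤ 2‖w‖², and c⁻¹/4 from w₂ = 2c(y - x), which gives c‖x -
  -- y‖² = ‖w₂‖²/(4c). For c = 0 the convention 0⁻¹ = 0 gives the right value.
  refine hasKLExponentAt_half_of_frechet (a := fracValue f g x) (C := 2 * max γ 0 + c⁻¹ / 4)
    ?_ ?_ hη ?_
  · rw [meritFunction_eq_coe h.ne_bot c (by simpa using hx)]
    simp
  · obtain ⟨u, hu⟩ := h.nonempty x hx
    -- The penalty is nonnegative and vanishes on the diagonal, so a subgradient of the objective
    -- padded by 0 works.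
    refine ⟨WithLp.toLp 2 (u, 0), ?_, ?_, fun ε hε => ?_⟩
    · rw [meritFunction_eq_coe h.ne_bot c (by simpa using hx)]; exact EReal.coe_ne_top _
    · rw [meritFunction_eq_coe h.ne_bot c (by simpa using hx)]; exact EReal.coe_ne_bot _
    have hcont : Tendsto (fun z : WithLp 2 (E × E) => z.fst) (𝓝 (WithLp.toLp 2 (x, x))) (𝓝 x) :=
      (WithLp.continuous_fst 2 E E).tendsto _
    filter_upwards [hcont.eventually (hu.2.2 ε hε)] with z hz
    rw [meritFunction_eq_coe h.ne_bot c (by simpa using hx)]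
    rw [fracObjective_eq_coe g (h.ne_bot _) hx] at hz
    have h1 : (((fracValue f g x + inner ℝ u (z.fst - x) - ε * ‖z.fst - x‖ : ℝ)) : EReal) + 0
        ≤ meritFunction f g S c z := by
      refine add_le_add hz ?_
      exact_mod_cast (by positivity : 0 ≤ c * ‖z.fst - z.snd‖ ^ 2)
    refine le_trans ?_ h1
    rw [add_zero, EReal.coe_le_coe_iff]
    have h2 : ‖z.fst - x‖ ≤ ‖z - WithLp.toLp 2 (x, x)‖ := by
      simpa using WithLp.norm_fst_le _ (z - WithLp.toLp 2 (x, x))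
    simp only [WithLp.prod_inner_apply, EReal.toReal_coe]
    simp
    nlinarith
  · have hcont : Tendsto (fun z : WithLp 2 (E × E) => z.fst) (𝓝 (WithLp.toLp 2 (x, x))) (𝓝 x) :=
      (WithLp.continuous_fst 2 E E).tendsto _
    filter_upwards [hcont.eventually hKL] with z hz b hb h1 h2 w hw
    have hzD := fst_mem_fracDom_of_meritFunction_eq_coe h.ne_bot hb
    rw [meritFunction_eq_coe h.ne_bot c hzD, EReal.coe_eq_coe_iff] at hb
    have h3 : 0 ≤ c * ‖z.fst - z.snd‖ ^ 2 := by positivity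
    have h4 := hz hzD _ (fst_add_snd_mem_frechetSubdiff hw) (by linarith)
    have h5 := snd_eq_of_mem_frechetSubdiff h.ne_bot hzD hw
    have h6 := WithLp.prod_norm_sq_eq_of_L2 w
    have h7 : ‖w.fst + w.snd‖ ^ 2 ≤ 2 * ‖w‖ ^ 2 := by
      have : ‖w.fst + w.snd‖ ^ 2 ≤ (‖w.fst‖ + ‖w.snd‖) ^ 2 := by gcongr; exact norm_add_le _ _
      nlinarith [sq_nonneg (‖w.fst‖ - ‖w.snd‖)]
    have h8 : c * ‖z.fst - z.snd‖ ^ 2 = c⁻¹ / 4 * ‖w.snd‖ ^ 2 := by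
      rw [h5, norm_smul, norm_sub_rev z.fst, mul_pow, Real.norm_eq_abs, sq_abs]
      rcases eq_or_ne c 0 with rfl | hc0
      · simp
      · field_simp
        norm_num
    have h9 : ‖w.snd‖ ^ 2 ≤ ‖w‖ ^ 2 := by nlinarith [sq_nonneg ‖w.fst‖]
    calc b - fracValue f g x
        = fracValue f g z.fst - fracValue f g x + c * ‖z.fst - z.snd‖ ^ 2 := by rw [← hb]; ring
      _ ≤ max γ 0 * (2 * ‖w‖ ^ 2) + c⁻¹ / 4 * ‖w‖ ^ 2 := by
        refine add_le_add (h4.trans ?_) (h8.trans_le (by gcongr))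
        calc γ * ‖w.fst + w.snd‖ ^ 2 ≤ max γ 0 * ‖w.fst + w.snd‖ ^ 2 := by
              gcongr; exact le_max_left _ _
          _ ≤ _ := by gcongr
      _ = _ := by ring

end TameFraction

/-! ### Arithmetic of the parameters -/

section MeritConstant

/-- The arithmetic of the descent estimate under the boundedness condition. -/
theorem EPSGParams.value_le {p : EPSGParams} (hm : 0 < p.m) (hM : 0 < p.M) (hμ : 0 ≤ p.μbar)
    (hc : p.meritConst < p.δ / (2 * p.M) - p.μbar / (2 * √(p.m * p.M))) {γ θ θ' a b : ℝ}
    (hγm : p.m ≤ γ) (hγM : γ ≤ p.M)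
    (h : γ * θ' ≤ γ * θ - p.δ / 2 * a ^ 2 + p.μbar * (a * b) + p.ℓ / 2 * (p.κbar ^ 2 * b ^ 2)) :
    θ' + (p.δ / (2 * p.M) - p.μbar / (2 * √(p.m * p.M))) * a ^ 2
      ≤ θ + p.meritConst * b ^ 2 := by
  have hγ : 0 < γ := hm.trans_le hγm
  set s := √(p.m * p.M) with hs
  have hs0 : 0 < s := Real.sqrt_pos.2 (by positivity)
  have hs2 : s ^ 2 = p.m * p.M := Real.sq_sqrt (by positivity)
  -- Young's inequality, weighted so that the cross term costs μbar/(2√(mM)) both after division of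
  -- the a² part by M and of the b² part by m.
  have hab : a * b ≤ p.M / (2 * s) * a ^ 2 + p.m / (2 * s) * b ^ 2 := by
    have h1 : p.M / (2 * s) * a ^ 2 + p.m / (2 * s) * b ^ 2 - a * b
        = (p.M * a - s * b) ^ 2 / (2 * s * p.M) := by
      field_simp
      linear_combination b ^ 2 * (-1) * hs2
    have h2 : 0 ≤ (p.M * a - s * b) ^ 2 / (2 * s * p.M) := by positivity
    linarith
  set A := p.δ / (2 * p.M) - p.μbar / (2 * s) with hA
  have hc0 : 0 ≤ p.meritConst := by unfold EPSGParams.meritConst; positivity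
  have hA0 : 0 ≤ A := hc0.trans hc.le
  have e1 : p.M * A = p.δ / 2 - p.μbar * (p.M / (2 * s)) := by rw [hA]; field_simp
  have e2 : p.m * p.meritConst = p.ℓ / 2 * p.κbar ^ 2 + p.μbar * (p.m / (2 * s)) := by
    rw [EPSGParams.meritConst, ← hs]; field_simp
  have h1 : γ * A ≤ p.M * A := by gcongr
  have h2 : p.m * p.meritConst ≤ γ * p.meritConst := by gcongr
  have h3 := mul_le_mul_of_nonneg_left hab hμ
  have h4 := mul_le_mul_of_nonneg_right h1 (sq_nonneg a)
  have h5 := mul_le_mul_of_nonneg_right h2 (sq_nonneg b)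
  rw [e1] at h4
  rw [e2] at h5
  refine le_of_mul_le_mul_left ?_ hγ
  linarith

/-- The upper bounds on `μbar` and `κbar` amount to this inequality with δ(1 - √β ζ) in place of δ;
that factor is at most 1. The strict gap becomes the descent constant. -/
theorem EPSGParams.Admissible.meritConst_lt {E : Type*} {p : EPSGParams} {f : E → EReal}
    {g : E → ℝ} {S : Set E} (hp : p.Admissible f g S) (hBC : BoundednessCondition f g S p.m p.M)
    (hμ : p.μbar < p.δ * (1 - √p.β * p.ζ) * √(p.m * p.M) / (2 * p.M)) (hκ0 : 0 ≤ p.κbar)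
    (hκ : 0 < p.ℓ → p.κbar < √(p.m * p.δ * (1 - √p.β * p.ζ) / (p.ℓ * p.M)
        - 2 * p.m * p.μbar / (p.ℓ * √(p.m * p.M)))) :
    p.meritConst < p.δ / (2 * p.M) - p.μbar / (2 * √(p.m * p.M)) := by
  obtain ⟨hm, hM, -⟩ := hBC
  set s := √(p.m * p.M) with hs
  have hs0 : 0 < s := Real.sqrt_pos.2 (by positivity)
  set q := 1 - √p.β * p.ζ with hq
  have hq1 : q ≤ 1 := by
    have := hp.ζ_pos
    rw [hq]
    linarith [mul_nonneg (Real.sqrt_nonneg p.β) this.le]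
  have hδ := hp.δ_pos
  have h1 : p.δ * q / (2 * p.M) ≤ p.δ / (2 * p.M) := by
    gcongr
    nlinarith
  suffices h : p.meritConst < p.δ * q / (2 * p.M) - p.μbar / (2 * s) by linarith
  -- For ℓ = 0 there is no upper bound on `κbar`, but its term vanishes and the bound on `μbar`
  -- suffices.
  rcases eq_or_lt_of_le (zero_le : 0 ≤ p.ℓ) with hℓ | hℓ
  · have h2 : p.meritConst = p.μbar / (2 * s) := by
      simp [EPSGParams.meritConst, ← hℓ, hs]
    have h3 : p.μbar / s < p.δ * q / (2 * p.M) := by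
      rw [div_lt_iff₀ hs0]
      calc _ < _ := hμ
        _ = _ := by ring
    have h4 : p.μbar / s = p.μbar / (2 * s) + p.μbar / (2 * s) := by field_simp; norm_num
    linarith
  · have hℓ' : (0 : ℝ) < p.ℓ := hℓ
    have h2 := (Real.lt_sqrt hκ0).1 (hκ hℓ)
    have h3 : p.ℓ * p.κbar ^ 2 / (2 * p.m) < p.δ * q / (2 * p.M) - p.μbar / s := by
      have h4 : p.ℓ / (2 * p.m) * p.κbar ^ 2 < p.ℓ / (2 * p.m) * (p.m * p.δ * q / (p.ℓ * p.M)
        - 2 * p.m * p.μbar / (p.ℓ * s)) := by gcongr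
      calc _ = p.ℓ / (2 * p.m) * p.κbar ^ 2 := by ring
        _ < _ := h4
        _ = _ := by field_simp
    have h4 : p.μbar / s = p.μbar / (2 * s) + p.μbar / (2 * s) := by field_simp; norm_num
    rw [EPSGParams.meritConst, ← hs]
    linarith

end MeritConstant

/-! ### One step of the algorithm -/

section ExtrapolatedProximalSubgradient

variable {E : Type*} [NormedAddCommGroup E] [InnerProductSpace ℝ E]

section Step

variable [CompleteSpace E] {f : E → EReal} {fs : E → ℝ} {fn : E → EReal} {ℓ : ℝ≥0}

theorem IsNumeratorSplitting.ne_top_iff (hs : IsNumeratorSplitting f fs fn ℓ) (x : E) :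
    f x ≠ ⊤ ↔ fn x ≠ ⊤ := by
  rw [hs.eq_add x, not_iff_not]
  constructor
  · intro h
    by_contra ht
    lift fn x to ℝ using ⟨ht, hs.ne_bot x⟩ with b
    rw [← EReal.coe_add] at h
    exact EReal.coe_ne_top _ h
  · intro h
    rw [h, EReal.coe_add_top]

theorem IsNumeratorSplitting.eq_coe (hs : IsNumeratorSplitting f fs fn ℓ) {x : E} (hx : f x ≠ ⊤) :
    fn x = (((f x).toReal - fs x : ℝ) : EReal) := by
  have ht := (hs.ne_top_iff x).1 hx
  rw [hs.eq_add x]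
  lift fn x to ℝ using ⟨ht, hs.ne_bot x⟩ with b
  rw [← EReal.coe_add, EReal.toReal_coe]
  simp

/-- A minimizer of the subproblem over `S` lies in the domain of `f`, and its optimality is an
inequality between real numbers. -/
theorem IsNumeratorSplitting.le_of_isMinOn (hs : IsNumeratorSplitting f fs fn ℓ) {S : Set E}
    {τ θ : ℝ} {w u v x' : E} (hmem : x' ∈ S) (hne : (fracDom f S).Nonempty)
    (hmin : IsMinOn (epsgSubproblem fs fn ℓ τ θ w u v) S x') :
    x' ∈ fracDom f S ∧ ∀ y ∈ fracDom f S,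
      (f x').toReal - fs x' + inner ℝ (gradient fs u) (x' - u)
        + 1 / (2 * τ) * ‖x' - v - (τ * θ) • w‖ ^ 2 + ℓ / 2 * ‖x' - u‖ ^ 2 ≤
      (f y).toReal - fs y + inner ℝ (gradient fs u) (y - u)
        + 1 / (2 * τ) * ‖y - v - (τ * θ) • w‖ ^ 2 + ℓ / 2 * ‖y - u‖ ^ 2 := by
  have hD : x' ∈ fracDom f S := by
    obtain ⟨y, hy⟩ := hne
    refine ⟨hmem, (hs.ne_top_iff x').2 fun ht => ?_⟩
    have h := isMinOn_iff.1 hmin y hy.1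
    rw [epsgSubproblem, epsgSubproblem, ht, EReal.top_add_coe, hs.eq_coe hy.2,
      ← EReal.coe_add] at h
    exact EReal.coe_ne_top _ (top_le_iff.1 h)
  refine ⟨hD, fun y hy => ?_⟩
  have h := isMinOn_iff.1 hmin y hy.1
  rw [epsgSubproblem, epsgSubproblem, hs.eq_coe hy.2, hs.eq_coe hD.2, ← EReal.coe_add,
    ← EReal.coe_add, EReal.coe_le_coe_iff] at h
  linarith

/-- The decrease of the numerator in one step. -/
theorem IsNumeratorSplitting.numerator_le (hs : IsNumeratorSplitting f fs fn ℓ)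
    {τ θ κ μ : ℝ} (hτ : 0 < τ) {w x x' Δ : E}
    (h : (f x').toReal - fs x' + inner ℝ (gradient fs (x + κ • Δ)) (x' - (x + κ • Δ))
        + 1 / (2 * τ) * ‖x' - (x + μ • Δ) - (τ * θ) • w‖ ^ 2 + ℓ / 2 * ‖x' - (x + κ • Δ)‖ ^ 2 ≤
      (f x).toReal - fs x + inner ℝ (gradient fs (x + κ • Δ)) (x - (x + κ • Δ))
        + 1 / (2 * τ) * ‖x - (x + μ • Δ) - (τ * θ) • w‖ ^ 2 + ℓ / 2 * ‖x - (x + κ • Δ)‖ ^ 2) :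
    (f x').toReal ≤ (f x).toReal + θ * inner ℝ w (x' - x) - 1 / (2 * τ) * ‖x' - x‖ ^ 2
      + μ / τ * inner ℝ (x' - x) Δ + ℓ / 2 * (κ ^ 2 * ‖Δ‖ ^ 2) := by
  set u := x + κ • Δ with hu
  have hd : Differentiable ℝ fs := hs.contDiff.differentiable one_ne_zero
  -- The descent lemma at u bounds fs(x') from above and convexity at u bounds fs(x) from below. The
  -- term (ℓ/2)‖x' - u‖² cancels, leaving (ℓ/2)‖x - u‖² as the price of extrapolation.
  have h1 := le_add_of_lipschitzWith_gradient hd hs.lipschitz u x'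
  have h2 := hs.convex.le_of_hasGradientAt (hd u).hasGradientAt x
  have h3 : ‖x - u‖ ^ 2 = κ ^ 2 * ‖Δ‖ ^ 2 := by
    rw [hu, sub_add_cancel_left, norm_neg, norm_smul, mul_pow, Real.norm_eq_abs, sq_abs]
  have h4 : ‖x' - (x + μ • Δ) - (τ * θ) • w‖ ^ 2 - ‖x - (x + μ • Δ) - (τ * θ) • w‖ ^ 2
      = ‖x' - x‖ ^ 2 - 2 * (μ * inner ℝ (x' - x) Δ) - 2 * (τ * θ * inner ℝ w (x' - x)) := by
    have e : x' - (x + μ • Δ) - (τ * θ) • w = (x' - x) + (x - (x + μ • Δ) - (τ * θ) • w) := by abel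
    rw [e, norm_add_sq_real, sub_add_cancel_left, inner_sub_right, inner_neg_right,
      inner_smul_right, inner_smul_right, real_inner_comm w]
    ring
  have h5 : 1 / (2 * τ) * (‖x' - (x + μ • Δ) - (τ * θ) • w‖ ^ 2
      - ‖x - (x + μ • Δ) - (τ * θ) • w‖ ^ 2) = 1 / (2 * τ) * ‖x' - x‖ ^ 2
      - μ / τ * inner ℝ (x' - x) Δ - θ * inner ℝ w (x' - x) := by
    rw [h4]; field_simp
  rw [h3] at h
  linarith

/-- The minimizer of the subproblem has a subgradient of the numerator with a quadratic error. -/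
theorem IsNumeratorSplitting.exists_quadratic_minorant (hs : IsNumeratorSplitting f fs fn ℓ)
    {τ θ : ℝ} (hτ : 0 < τ) {w u v x' y : E}
    (h : (f x').toReal - fs x' + inner ℝ (gradient fs u) (x' - u)
        + 1 / (2 * τ) * ‖x' - v - (τ * θ) • w‖ ^ 2 + ℓ / 2 * ‖x' - u‖ ^ 2 ≤
      (f y).toReal - fs y + inner ℝ (gradient fs u) (y - u)
        + 1 / (2 * τ) * ‖y - v - (τ * θ) • w‖ ^ 2 + ℓ / 2 * ‖y - u‖ ^ 2) :
    (f x').toReal + inner ℝ (gradient fs x' - gradient fs u - τ⁻¹ • (x' - v) + θ • w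
      - (ℓ : ℝ) • (x' - u)) (y - x') - (1 / (2 * τ) + ℓ / 2) * ‖y - x'‖ ^ 2 ≤ (f y).toReal := by
  have hd : Differentiable ℝ fs := hs.contDiff.differentiable one_ne_zero
  have h2 := hs.convex.le_of_hasGradientAt (hd x').hasGradientAt y
  have h3 : ‖y - u‖ ^ 2 = ‖y - x'‖ ^ 2 + 2 * inner ℝ (x' - u) (y - x') + ‖x' - u‖ ^ 2 := by
    rw [← sub_add_sub_cancel y x' u, norm_add_sq_real, real_inner_comm (x' - u)]
  have h4 : ‖y - v - (τ * θ) • w‖ ^ 2 = ‖y - x'‖ ^ 2 + 2 * (inner ℝ (x' - v) (y - x')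
      - τ * θ * inner ℝ w (y - x')) + ‖x' - v - (τ * θ) • w‖ ^ 2 := by
    have e : y - v - (τ * θ) • w = (y - x') + (x' - v - (τ * θ) • w) := by abel
    rw [e, norm_add_sq_real, inner_sub_right, inner_smul_right, real_inner_comm w,
      real_inner_comm (x' - v)]
  have h5 : 1 / (2 * τ) * ‖y - v - (τ * θ) • w‖ ^ 2 = 1 / (2 * τ) * ‖y - x'‖ ^ 2
      + τ⁻¹ * inner ℝ (x' - v) (y - x') - θ * inner ℝ w (y - x')
      + 1 / (2 * τ) * ‖x' - v - (τ * θ) • w‖ ^ 2 := by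
    rw [h4]; field_simp; ring
  have h6 : inner ℝ (gradient fs u) (y - u)
      = inner ℝ (gradient fs u) (y - x') + inner ℝ (gradient fs u) (x' - u) := by
    rw [← inner_add_right, sub_add_sub_cancel]
  rw [h5, h3, h6] at h
  simp only [inner_sub_left, inner_add_left, real_inner_smul_left] at h ⊢
  linarith

/-- Dividing the quadratic minorant of f by g > 0 gives a function differentiable at x, below the
objective and touching it at x; the quotient rule computes its gradient. -/
theorem mem_frechetSubdiff_fracObjective {g : E → ℝ} {S : Set E} {G : E → E}
    (hf : IsTameFraction f g S G) {x p : E} (hx : x ∈ fracDom f S) {K : ℝ}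
    (h : ∀ y ∈ fracDom f S,
      (f x).toReal + inner ℝ p (y - x) - K * ‖y - x‖ ^ 2 ≤ (f y).toReal) :
    (g x)⁻¹ • (p - fracValue f g x • G x) ∈ frechetSubdiff (fracObjective f g S) x := by
  have hn : HasGradientAt (fun y => (f x).toReal + inner ℝ p (y - x) - K * ‖y - x‖ ^ 2) p x := by
    rw [hasGradientAt_iff_hasFDerivAt]
    have h1 := HasFDerivAt.comp (g := innerSL ℝ p) (f := fun y => y - x) x
      (innerSL ℝ p).hasFDerivAt ((hasFDerivAt_id x).sub_const x)
    have h2 := (HasFDerivAt.comp (g := fun y : E => ‖y‖ ^ 2) (f := fun y => y - x) x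
      (hasStrictFDerivAt_norm_sq (x - x)).hasFDerivAt
      ((hasFDerivAt_id x).sub_const x)).const_mul K
    refine ((h1.const_add (f x).toReal).sub h2).congr_fderiv ?_
    ext d
    simp
  have hg := hf.hasGradientAt x hx
  have hR := hn.fun_div hg (hf.pos x hx).ne'
  simp only [sub_self, inner_zero_right, add_zero, norm_zero, ne_eq, OfNat.ofNat_ne_zero,
    not_false_eq_true, zero_pow, mul_zero, sub_zero] at hR
  refine mem_frechetSubdiff_of_minorant hR ?_ ?_
  · rw [fracObjective_eq_coe g (hf.ne_bot x) hx]
    simp [fracValue]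
  · refine Eventually.of_forall fun y => ?_
    by_cases hy : y ∈ fracDom f S
    · rw [fracObjective_eq_coe g (hf.ne_bot y) hy, EReal.coe_le_coe_iff, fracValue]
      have := hf.pos y hy
      gcongr
      exact h y hy
    · rw [fracObjective_eq_top g (hf.ne_bot y) hy]
      exact le_top

end Step

end ExtrapolatedProximalSubgradient

/-! ### Descent, relative error and convergence of the iterates -/

section Convergence

variable {E : Type*} [NormedAddCommGroup E] [InnerProductSpace ℝ E] [CompleteSpace E]
  {f : E → EReal} {fs : E → ℝ} {fn : E → EReal} {g : E → ℝ} {S : Set E} {G : E → E}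
  {p : EPSGParams} {x w : ℕ → E} {τ κ μ : ℕ → ℝ}

theorem IsEPSGSequence.zero_mem_fracDom (hx : IsEPSGSequence f fs fn g S p x w τ κ μ) :
    x 0 ∈ fracDom f S := ⟨hx.init_mem, hx.init_dom⟩

theorem IsEPSGSequence.mem_fracDom (hs : IsNumeratorSplitting f fs fn p.ℓ)
    (hx : IsEPSGSequence f fs fn g S p x w τ κ μ) : ∀ n, x n ∈ fracDom f S
  | 0 => hx.zero_mem_fracDom
  | n + 1 => (hs.le_of_isMinOn (hx.step_mem n) ⟨x 0, hx.zero_mem_fracDom⟩ (hx.step_isMinOn n)).1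

theorem IsEPSGSequence.toReal_fracQuotient (hf : IsTameFraction f g S G)
    (hs : IsNumeratorSplitting f fs fn p.ℓ)
    (hx : IsEPSGSequence f fs fn g S p x w τ κ μ) (n : ℕ) :
    (fracQuotient f g (x n)).toReal = fracValue f g (x n) := by
  rw [fracQuotient_eq_coe g (hf.ne_bot _) (hx.mem_fracDom hs n).2, EReal.toReal_coe]

theorem IsEPSGSequence.delta_le_inv (hp : p.Admissible f g S)
    (hx : IsEPSGSequence f fs fn g S p x w τ κ μ) (n : ℕ) : p.δ ≤ (τ n)⁻¹ := by
  have h1 := hx.τ_le n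
  have h2 := hx.τ_pos n
  have hδ := hp.δ_pos
  rw [le_inv_comm₀ hδ h2]
  refine h1.trans ?_
  rw [one_div]
  gcongr
  exact le_max_right _ _

theorem IsEPSGSequence.eq_gradient (hf : IsTameFraction f g S G)
    (hs : IsNumeratorSplitting f fs fn p.ℓ)
    (hx : IsEPSGSequence f fs fn g S p x w τ κ μ) (n : ℕ) : w n = G (x n) :=
  hf.convexOn.eq_gradient_of_mem_limitingSubdiff (hf.hasGradientAt _ (hx.mem_fracDom hs n))
    (hx.subgrad n)

/-- Since θ_n ≥ 0, convexity of g bounds θ_n⟨g_n, x_{n+1} - x_n⟩ by θ_n(g(x_{n+1}) - g(x_n)), and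
f(x_n) = θ_n g(x_n) cancels. The factor g(x_{n+1}) is kept because dividing it out requires an upper
bound on g, obtained differently with and without (BC). -/
theorem IsEPSGSequence.mul_value_le (hf : IsTameFraction f g S G)
    (hs : IsNumeratorSplitting f fs fn p.ℓ) (hp : p.Admissible f g S)
    (hx : IsEPSGSequence f fs fn g S p x w τ κ μ) (n : ℕ) :
    g (x (n + 1)) * fracValue f g (x (n + 1)) ≤ g (x (n + 1)) * fracValue f g (x n)
      - p.δ / 2 * ‖x (n + 1) - x n‖ ^ 2
      + p.μbar * (‖x (n + 1) - x n‖ * ‖x n - x (n - 1)‖)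
      + p.ℓ / 2 * (p.κbar ^ 2 * ‖x n - x (n - 1)‖ ^ 2) := by
  have hD := hx.mem_fracDom hs n
  have hD' := hx.mem_fracDom hs (n + 1)
  have hτ := hx.τ_pos n
  have h1 := hs.numerator_le hτ ((hs.le_of_isMinOn (hx.step_mem n) ⟨x 0, hx.zero_mem_fracDom⟩
    (hx.step_isMinOn n)).2 _ hD)
  rw [hx.toReal_fracQuotient hf hs] at h1
  have hg := hf.pos _ hD
  have hg' := hf.pos _ hD'
  have e1 : g (x (n + 1)) * fracValue f g (x (n + 1)) = (f (x (n + 1))).toReal := by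
    rw [fracValue]; field_simp
  have e2 : (f (x n)).toReal = fracValue f g (x n) * g (x n) := by
    rw [fracValue]; field_simp
  have hθ : 0 ≤ fracValue f g (x n) := div_nonneg (hf.nonneg _ hD) hg.le
  have h2 := mul_le_mul_of_nonneg_left
    (hf.convexOn.le_of_mem_limitingSubdiff (hx.subgrad n) (x (n + 1))) hθ
  have h3 : p.δ / 2 * ‖x (n + 1) - x n‖ ^ 2 ≤ 1 / (2 * τ n) * ‖x (n + 1) - x n‖ ^ 2 := by
    have := hx.delta_le_inv hp n
    have e : 1 / (2 * τ n) = (τ n)⁻¹ / 2 := by field_simp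
    rw [e]
    gcongr
  have h4 : μ n / τ n * inner ℝ (x (n + 1) - x n) (x n - x (n - 1))
      ≤ p.μbar * (‖x (n + 1) - x n‖ * ‖x n - x (n - 1)‖) := by
    have h5 : μ n / τ n ≤ p.μbar := by
      rw [div_le_iff₀ hτ]; exact (hx.μ_mem n).2
    have h6 : 0 ≤ μ n / τ n := div_nonneg (hx.μ_mem n).1 hτ.le
    calc _ ≤ μ n / τ n * (‖x (n + 1) - x n‖ * ‖x n - x (n - 1)‖) := by
          gcongr; exact real_inner_le_norm _ _
      _ ≤ _ := by gcongr
  have h5 : (p.ℓ : ℝ) / 2 * (κ n ^ 2 * ‖x n - x (n - 1)‖ ^ 2)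
      ≤ p.ℓ / 2 * (p.κbar ^ 2 * ‖x n - x (n - 1)‖ ^ 2) := by
    have := hx.κ_mem n
    have h6 : κ n ^ 2 ≤ p.κbar ^ 2 := pow_le_pow_left₀ this.1 this.2 2
    gcongr
  rw [e1]
  linarith

/-- Under (BC) the parameter arithmetic applies. Without it there is no extrapolation, so the values
decrease, the iterates stay in the compact sublevel set, and the maximal size of g there plays the
role of M. -/
theorem IsEPSGSequence.exists_descent [FiniteDimensional ℝ E] (hf : IsTameFraction f g S G)
    (hs : IsNumeratorSplitting f fs fn p.ℓ) (hp : p.Admissible f g S)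
    (hx : IsEPSGSequence f fs fn g S p x w τ κ μ)
    (hQ : IsCompact {y | y ∈ fracDom f S ∧ fracValue f g y ≤ fracValue f g (x 0)}) :
    0 ≤ p.meritConst ∧ (∀ n, fracValue f g (x n) ≤ fracValue f g (x 0)) ∧ ∃ ε : ℝ, 0 < ε ∧
      ∀ n, fracValue f g (x (n + 1)) + (p.meritConst + ε) * ‖x (n + 1) - x n‖ ^ 2
        ≤ fracValue f g (x n) + p.meritConst * ‖x n - x (n - 1)‖ ^ 2 := by
  have hD := hx.mem_fracDom hs
  have hstep := hx.mul_value_le hf hs hp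
  rcases hp.extrapolation with ⟨hBC, hμ0, hμ, hκ0, hκ⟩ | ⟨-, hμ, hκ⟩
  · have hlt := hp.meritConst_lt hBC hμ hκ0 hκ
    have hc0 : 0 ≤ p.meritConst := by
      have := hBC.1
      unfold EPSGParams.meritConst; positivity
    have hdesc : ∀ n, fracValue f g (x (n + 1))
        + (p.δ / (2 * p.M) - p.μbar / (2 * √(p.m * p.M))) * ‖x (n + 1) - x n‖ ^ 2
        ≤ fracValue f g (x n) + p.meritConst * ‖x n - x (n - 1)‖ ^ 2 := fun n => by
      obtain ⟨h1, h2⟩ := hBC.2.2 _ (hD (n + 1)).1 (hD (n + 1)).2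
      exact EPSGParams.value_le hBC.1 hBC.2.1 hμ0 hlt h1 h2 (hstep n)
    refine ⟨hc0, fun n => ?_, p.δ / (2 * p.M) - p.μbar / (2 * √(p.m * p.M)) - p.meritConst,
      by linarith, fun n => by simpa using hdesc n⟩
    have h : fracValue f g (x n) + p.meritConst * ‖x n - x (n - 1)‖ ^ 2
        ≤ fracValue f g (x 0) := by
      induction n with
      | zero => simp
      | succ n ih =>
        have h1 := hdesc n
        have h2 : p.meritConst * ‖x (n + 1) - x n‖ ^ 2
          ≤ (p.δ / (2 * p.M) - p.μbar / (2 * √(p.m * p.M))) * ‖x (n + 1) - x n‖ ^ 2 := by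
          gcongr
        simp only [Nat.add_sub_cancel]
        linarith
    have : 0 ≤ p.meritConst * ‖x n - x (n - 1)‖ ^ 2 := by positivity
    linarith
  · have hc : p.meritConst = 0 := by simp [EPSGParams.meritConst, hμ, hκ]
    have hstep' : ∀ n, g (x (n + 1)) * fracValue f g (x (n + 1))
        + p.δ / 2 * ‖x (n + 1) - x n‖ ^ 2 ≤ g (x (n + 1)) * fracValue f g (x n) := fun n => by
      have := hstep n
      simp only [hμ, hκ] at this
      linarith
    have hδ := hp.δ_pos
    have hmono : ∀ n, fracValue f g (x n) ≤ fracValue f g (x 0) := fun n => by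
      induction n with
      | zero => exact le_rfl
      | succ n ih =>
        refine le_trans (le_of_mul_le_mul_left ?_ (hf.pos _ (hD (n + 1)))) ih
        have h1 := hstep' n
        have : 0 ≤ p.δ / 2 * ‖x (n + 1) - x n‖ ^ 2 := by positivity
        linarith
    have hgc : ContinuousOn g {y | y ∈ fracDom f S ∧ fracValue f g y ≤ fracValue f g (x 0)} :=
      fun y hy => (hf.hasGradientAt y hy.1).continuousAt.continuousWithinAt
    obtain ⟨B, hB⟩ := hQ.exists_bound_of_continuousOn hgc
    have hgB : ∀ n, g (x n) ≤ B := fun n => (le_abs_self _).trans (hB _ ⟨hD n, hmono n⟩)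
    have hB0 : 0 < B := (hf.pos _ (hD 0)).trans_le (hgB 0)
    refine ⟨hc.ge, hmono, p.δ / (2 * B), by positivity, fun n => ?_⟩
    rw [hc, zero_add, zero_mul, add_zero]
    refine le_of_mul_le_mul_left ?_ (hf.pos _ (hD (n + 1)))
    have h1 : g (x (n + 1)) * (p.δ / (2 * B)) ≤ p.δ / 2 := by
      calc _ ≤ B * (p.δ / (2 * B)) := by gcongr; exact hgB _
        _ = _ := by field_simp
    have h2 := mul_le_mul_of_nonneg_right h1 (sq_nonneg ‖x (n + 1) - x n‖)
    linarith [hstep' n]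

/-- Optimality in the subproblem gives the subgradient. Its terms are controlled by the last two
displacements: by the Lipschitz gradient of fs, by bounds on 1/τ_n and μ_n/τ_n, and by Lipschitz
continuity of (f/g)·G on the compact sublevel set, where 1/g is bounded too. -/
theorem IsEPSGSequence.exists_subgradient_bound (hf : IsTameFraction f g S G)
    (hs : IsNumeratorSplitting f fs fn p.ℓ)
    (hx : IsEPSGSequence f fs fn g S p x w τ κ μ)
    (hQ : IsCompact {y | y ∈ fracDom f S ∧ fracValue f g y ≤ fracValue f g (x 0)})
    (hmono : ∀ n, fracValue f g (x n) ≤ fracValue f g (x 0)) (hτ : 0 < liminf τ atTop)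
    (hτb : BddBelow (range τ)) :
    ∃ (ξ : ℕ → E) (C : ℝ), (∀ n, ξ n ∈ frechetSubdiff (fracObjective f g S) (x (n + 1))) ∧
      ∀ n, ‖ξ n‖ ≤ C * (‖x (n + 1) - x n‖ + ‖x n - x (n - 1)‖) := by
  have hD := hx.mem_fracDom hs
  set Q := {y | y ∈ fracDom f S ∧ fracValue f g y ≤ fracValue f g (x 0)} with hQdef
  have hxQ : ∀ n, x n ∈ Q := fun n => ⟨hD n, hmono n⟩
  -- The positive lower limit bounds 1/τ_n for large n; the remaining indices are finitely many.
  obtain ⟨T, hT⟩ : ∃ T : ℝ, ∀ n, (τ n)⁻¹ ≤ T := by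
    obtain ⟨n₀, hn₀⟩ := eventually_atTop.1 (eventually_lt_of_lt_liminf (half_lt_self hτ)
      hτb.isBoundedUnder_of_range)
    obtain ⟨T, hT⟩ := (finite_Iio n₀).image (fun n => (τ n)⁻¹) |>.bddAbove
    refine ⟨max T (liminf τ atTop / 2)⁻¹, fun n => ?_⟩
    rcases lt_or_ge n n₀ with h | h
    · exact le_max_of_le_left (hT ⟨n, h, rfl⟩)
    · refine le_max_of_le_right ?_
      gcongr
      exact (hn₀ n h).le
  obtain ⟨z, hzQ, hz⟩ := hQ.exists_isMinOn ⟨x 0, hxQ 0⟩ (f := g)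
    (fun y hy => (hf.hasGradientAt y hy.1).continuousAt.continuousWithinAt)
  have hgz := hf.pos z hzQ.1
  have hgi : ∀ n, (g (x n))⁻¹ ≤ (g z)⁻¹ := fun n => by
    gcongr
    exact hz (hxQ n)
  obtain ⟨L, hL, -, hLip⟩ := (hf.lipschitz_value Q (fun y hy => hy.1) hQ).smul
    (hf.lipschitz_gradient Q (fun y hy => hy.1) hQ)
  set P : ℕ → E := fun n => gradient fs (x (n + 1)) - gradient fs (x n + κ n • (x n - x (n - 1)))
      - (τ n)⁻¹ • (x (n + 1) - (x n + μ n • (x n - x (n - 1)))) + fracValue f g (x n) • w n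
      - (p.ℓ : ℝ) • (x (n + 1) - (x n + κ n • (x n - x (n - 1)))) with hP
  refine ⟨fun n => (g (x (n + 1)))⁻¹ • (P n - fracValue f g (x (n + 1)) • G (x (n + 1))),
    (g z)⁻¹ * (2 * p.ℓ * max 1 p.κbar + max T p.μbar + L), fun n => ?_, fun n => ?_⟩
  · refine mem_frechetSubdiff_fracObjective hf (hD (n + 1))
      (K := 1 / (2 * τ n) + p.ℓ / 2) fun y hy => ?_
    have h := (hs.le_of_isMinOn (hx.step_mem n) ⟨x 0, hx.zero_mem_fracDom⟩
      (hx.step_isMinOn n)).2 y hy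
    rw [hx.toReal_fracQuotient hf hs] at h
    exact hs.exists_quadratic_minorant (hx.τ_pos n) h
  · set a := ‖x (n + 1) - x n‖ with ha
    set b := ‖x n - x (n - 1)‖ with hb
    have ha0 : 0 ≤ a := norm_nonneg _
    have hb0 : 0 ≤ b := norm_nonneg _
    have hu : ‖x (n + 1) - (x n + κ n • (x n - x (n - 1)))‖ ≤ max 1 p.κbar * (a + b) := by
      rw [← sub_sub]
      refine (norm_sub_le _ _).trans ?_
      rw [norm_smul, Real.norm_of_nonneg (hx.κ_mem n).1, ← ha, ← hb, mul_add]
      have := (hx.κ_mem n).2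
      have h1 : a ≤ max 1 p.κbar * a := le_mul_of_one_le_left ha0 (le_max_left _ _)
      have h2 : κ n * b ≤ max 1 p.κbar * b := by
        gcongr; exact this.trans (le_max_right _ _)
      linarith
    have h1 : ‖gradient fs (x (n + 1)) - gradient fs (x n + κ n • (x n - x (n - 1)))‖
        ≤ p.ℓ * (max 1 p.κbar * (a + b)) :=
      (hs.lipschitz.norm_sub_le _ _).trans (by gcongr)
    have h2 : ‖(p.ℓ : ℝ) • (x (n + 1) - (x n + κ n • (x n - x (n - 1))))‖
        ≤ p.ℓ * (max 1 p.κbar * (a + b)) := by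
      rw [norm_smul, Real.norm_of_nonneg (NNReal.coe_nonneg _)]
      gcongr
    have h3 : ‖(τ n)⁻¹ • (x (n + 1) - (x n + μ n • (x n - x (n - 1))))‖
        ≤ max T p.μbar * (a + b) := by
      have hτn := hx.τ_pos n
      rw [norm_smul, Real.norm_of_nonneg (inv_nonneg.2 hτn.le), ← sub_sub]
      have h4 : ‖x (n + 1) - x n - μ n • (x n - x (n - 1))‖ ≤ a + μ n * b := by
        refine (norm_sub_le _ _).trans ?_
        rw [norm_smul, Real.norm_of_nonneg (hx.μ_mem n).1]
      have h5 : (τ n)⁻¹ * μ n ≤ max T p.μbar := by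
        rw [inv_mul_eq_div]
        refine le_max_of_le_right ?_
        rw [div_le_iff₀ hτn]
        exact (hx.μ_mem n).2
      have h6 : (τ n)⁻¹ ≤ max T p.μbar := (hT n).trans (le_max_left _ _)
      calc _ ≤ (τ n)⁻¹ * (a + μ n * b) := by gcongr
        _ = (τ n)⁻¹ * a + (τ n)⁻¹ * μ n * b := by ring
        _ ≤ max T p.μbar * a + max T p.μbar * b := by gcongr
        _ = _ := by ring
    have h4 : ‖fracValue f g (x n) • G (x n) - fracValue f g (x (n + 1)) • G (x (n + 1))‖
        ≤ L * (a + b) := by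
      refine (hLip _ (hxQ n) _ (hxQ (n + 1))).trans ?_
      rw [norm_sub_rev]
      gcongr
      linarith
    have hsum : ‖P n - fracValue f g (x (n + 1)) • G (x (n + 1))‖
        ≤ (2 * p.ℓ * max 1 p.κbar + max T p.μbar + L) * (a + b) := by
      have e : P n - fracValue f g (x (n + 1)) • G (x (n + 1))
          = (gradient fs (x (n + 1)) - gradient fs (x n + κ n • (x n - x (n - 1))))
          - ((τ n)⁻¹ • (x (n + 1) - (x n + μ n • (x n - x (n - 1)))))
          - ((p.ℓ : ℝ) • (x (n + 1) - (x n + κ n • (x n - x (n - 1)))))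
          + (fracValue f g (x n) • G (x n) - fracValue f g (x (n + 1)) • G (x (n + 1))) := by
        simp only [hP, hx.eq_gradient hf hs]
        abel
      rw [e]
      refine (norm_add_le _ _).trans ?_
      have e1 := (norm_sub_le ((gradient fs (x (n + 1))
        - gradient fs (x n + κ n • (x n - x (n - 1))))
          - ((τ n)⁻¹ • (x (n + 1) - (x n + μ n • (x n - x (n - 1))))))
          ((p.ℓ : ℝ) • (x (n + 1) - (x n + κ n • (x n - x (n - 1))))))
      have e2 := norm_sub_le (gradient fs (x (n + 1))
        - gradient fs (x n + κ n • (x n - x (n - 1))))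
          ((τ n)⁻¹ • (x (n + 1) - (x n + μ n • (x n - x (n - 1)))))
      linarith
    have hg0 := hf.pos _ (hD (n + 1))
    simp only
    rw [norm_smul, norm_inv, Real.norm_of_nonneg hg0.le, mul_assoc]
    exact mul_le_mul (hgi (n + 1)) hsum (norm_nonneg _) (inv_nonneg.2 hgz.le)

/-- R-linear convergence of e-PSG for a tame fraction. -/
theorem IsEPSGSequence.exists_linear_rate [FiniteDimensional ℝ E] (hf : IsTameFraction f g S G)
    (hs : IsNumeratorSplitting f fs fn p.ℓ) (hp : p.Admissible f g S)
    (hx : IsEPSGSequence f fs fn g S p x w τ κ μ)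
    (hbdd : Bornology.IsBounded {y | y ∈ S ∧ fracQuotient f g y ≤ fracQuotient f g (x 0)})
    (hτ : 0 < liminf τ atTop) :
    ∃ xlim, IsStationaryPoint f g S xlim ∧ f xlim ≠ ⊤ ∧
      ∃ γ₁ γ₂ ρ : ℝ, 0 < γ₁ ∧ 0 < γ₂ ∧ 0 < ρ ∧ ρ < 1 ∧ ∀ n : ℕ,
        x n ∈ S ∧ f (x n) ≠ ⊤ ∧
        |(meritFunction f g S p.meritConst (WithLp.toLp 2 (x (n + 1), x n))).toReal
          - (meritFunction f g S p.meritConst (WithLp.toLp 2 (xlim, xlim))).toReal| ≤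
            γ₁ * ρ ^ n ∧
        ‖x n - xlim‖ ≤ γ₂ * ρ ^ ((n : ℝ) / 2) := by
  have : ProperSpace E := FiniteDimensional.proper_real E
  have hD := hx.mem_fracDom hs
  have hQb : Bornology.IsBounded
      {y | y ∈ fracDom f S ∧ fracValue f g y ≤ fracValue f g (x 0)} := by
    refine hbdd.subset fun y hy => ⟨hy.1.1, ?_⟩
    rw [fracQuotient_eq_coe g (hf.ne_bot _) hy.1.2, fracQuotient_eq_coe g (hf.ne_bot _) (hD 0).2,
      EReal.coe_le_coe_iff]
    exact hy.2
  have hQc : IsCompact {y | y ∈ fracDom f S ∧ fracValue f g y ≤ fracValue f g (x 0)} :=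
    Metric.isCompact_of_isClosed_isBounded
      (hf.continuousOn.preimage_isClosed_of_isClosed hf.isClosed isClosed_Iic) hQb
  obtain ⟨hc, hmono, ε, hε, hdesc⟩ := hx.exists_descent hf hs hp hQc
  obtain ⟨ξ, C, hξ, hξC⟩ := hx.exists_subgradient_bound hf hs hQc hmono hτ
    ⟨0, by rintro _ ⟨n, rfl⟩; exact (hx.τ_pos n).le⟩
  obtain ⟨q, hqD, hxq, hξ0, γ₁, γ₂, ρ, h1, h2, h3, h4, hrate⟩ :=
    exists_linear_rate_of_descent hf.isClosed hf.continuousOn hD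
      (hQb.subset (by rintro _ ⟨n, rfl⟩; exact ⟨hD n, hmono n⟩))
      (fun y hy => div_nonneg (hf.nonneg y hy) (hf.pos y hy).le) hc hε hdesc hξ hξC
      hf.lojasiewicz
  have hx1 : Tendsto (fun n => x (n + 1)) atTop (𝓝 q) := hxq.comp (tendsto_add_atTop_nat 1)
  -- Stationarity is witnessed by the shifted iterates and the subgradients ξ, which tend to 0.
  refine ⟨q, ⟨hqD.1, ?_, ?_, fun n => x (n + 1), ξ, hx1, ?_, hξ0, hξ⟩, hqD.2,
    γ₁, γ₂, ρ, h1, h2, h3, h4, fun n => ⟨(hD n).1, (hD n).2, ?_, (hrate n).2⟩⟩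
  · rw [fracObjective_eq_coe g (hf.ne_bot _) hqD]; exact EReal.coe_ne_top _
  · rw [fracObjective_eq_coe g (hf.ne_bot _) hqD]; exact EReal.coe_ne_bot _
  · simp only [fracObjective_eq_coe g (hf.ne_bot _) hqD,
      fracObjective_eq_coe g (hf.ne_bot _) (hD _)]
    refine EReal.tendsto_coe.2 ((hf.continuousOn q hqD).tendsto.comp ?_)
    exact tendsto_nhdsWithin_iff.2 ⟨hx1, Eventually.of_forall fun n => hD _⟩
  · rw [meritFunction_eq_coe hf.ne_bot _ (by simpa using hD (n + 1)),
      meritFunction_eq_coe hf.ne_bot _ (by simpa using hqD)]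
    simpa only [EReal.toReal_coe, WithLp.toLp_fst, WithLp.toLp_snd, sub_self, norm_zero, ne_eq,
      OfNat.ofNat_ne_zero, not_false_eq_true, zero_pow, mul_zero, add_zero] using (hrate n).1

end Convergence

/-! ### Lipschitz continuity on compact sets -/

section CompactLipschitz

variable {E X : Type*} [NormedAddCommGroup E] [NormedAddCommGroup X]

theorem IsBoundedLipschitzOn.congr {a b : E → X} {Q : Set E} (ha : IsBoundedLipschitzOn a Q)
    (h : ∀ x ∈ Q, b x = a x) : IsBoundedLipschitzOn b Q := by
  obtain ⟨C, hC, h1, h2⟩ := ha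
  refine ⟨C, hC, fun x hx => ?_, fun x hx y hy => ?_⟩
  · rw [h x hx]; exact h1 x hx
  · rw [h x hx, h y hy]; exact h2 x hx y hy

theorem IsBoundedLipschitzOn.continuousOn {a : E → X} {Q : Set E}
    (ha : IsBoundedLipschitzOn a Q) : ContinuousOn a Q := by
  obtain ⟨C, hC, -, h⟩ := ha
  have : LipschitzOnWith ⟨C, hC⟩ a Q := LipschitzOnWith.of_dist_le_mul fun x hx y hy => by
    rw [dist_eq_norm, dist_eq_norm]; exact h x hx y hy
  exact this.continuousOn

theorem IsBoundedLipschitzOn.inv_of_pos {a : E → ℝ} {Q : Set E} (ha : IsBoundedLipschitzOn a Q)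
    (hQ : IsCompact Q) (hpos : ∀ x ∈ Q, 0 < a x) :
    IsBoundedLipschitzOn (fun x => (a x)⁻¹) Q := by
  rcases Q.eq_empty_or_nonempty with rfl | hne
  · exact ⟨0, le_rfl, by simp, by simp⟩
  · obtain ⟨z, hz, hmin⟩ := hQ.exists_isMinOn hne ha.continuousOn
    exact ha.inv (hpos z hz) fun x hx => hmin hx

end CompactLipschitz

/-- The part of the right side that is quadratic in s is absorbed by the left: η is chosen so that
2γβ²s² ≤ sq/2 for s < η. -/
theorem exists_le_mul_sq_of_mul_le_sq {q γ α β : ℝ} (hq : 0 < q) (hγ : 0 ≤ γ) :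
    ∃ γ' η : ℝ, 0 ≤ γ' ∧ 0 < η ∧ ∀ s t : ℝ, 0 ≤ s → s < η → s * q ≤ γ * (α * t + s * β) ^ 2 →
      s ≤ γ' * t ^ 2 := by
  refine ⟨4 * γ * α ^ 2 / q, q / (4 * γ * β ^ 2 + 1), by positivity, by positivity,
    fun s t hs hsη h => ?_⟩
  have h1 : s * (4 * γ * β ^ 2 + 1) ≤ q := by
    rw [lt_div_iff₀ (by positivity)] at hsη; exact hsη.le
  have h2 : γ * (α * t + s * β) ^ 2 ≤ 2 * γ * (α ^ 2 * t ^ 2) + 2 * γ * (s ^ 2 * β ^ 2) := by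
    nlinarith [mul_nonneg hγ (sq_nonneg (α * t - s * β))]
  have h3 : 2 * γ * (s ^ 2 * β ^ 2) ≤ s * q / 2 := by
    have := mul_le_mul_of_nonneg_left h1 hs
    nlinarith
  rw [div_mul_eq_mul_div, le_div_iff₀ hq]
  linarith

/-! ### The Rayleigh quotient on the sphere -/

section Rayleigh

variable {E : Type*} [NormedAddCommGroup E] [InnerProductSpace ℝ E]

theorem LinearMap.IsSymmetric.hasGradientAt_inner_self [CompleteSpace E] [FiniteDimensional ℝ E]
    {T : E →ₗ[ℝ] E} (hT : T.IsSymmetric) (x : E) :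
    HasGradientAt (fun y => inner ℝ y (T y)) ((2 : ℝ) • T x) x := by
  rw [hasGradientAt_iff_hasFDerivAt]
  have h := (hasFDerivAt_id (𝕜 := ℝ) x).inner ℝ (T.toContinuousLinearMap.hasFDerivAt (x := x))
  refine h.congr_fderiv ?_
  ext d
  have h1 : inner ℝ x (T d) = inner ℝ (T x) d := (hT x d).symm
  simp [h1, real_inner_comm (T x) d]
  ring

theorem LinearMap.convexOn_inner_self {T : E →ₗ[ℝ] E}
    (hpos : ∀ x, 0 ≤ inner ℝ x (T x)) : ConvexOn ℝ univ fun x => inner ℝ x (T x) := by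
  refine ⟨convex_univ, fun x _ y _ a b ha hb hab => ?_⟩
  have h := mul_nonneg (mul_nonneg ha hb) (hpos (x - y))
  obtain rfl : b = 1 - a := by linarith
  simp only [map_add, map_smul, map_sub, inner_add_left, inner_add_right, inner_sub_left,
    inner_sub_right, real_inner_smul_left, real_inner_smul_right, smul_eq_mul] at h ⊢
  nlinarith

theorem isBoundedLipschitzOn_inner_self [FiniteDimensional ℝ E] (T : E →ₗ[ℝ] E) {Q : Set E}
    (hQ : IsCompact Q) : IsBoundedLipschitzOn (fun x => inner ℝ x (T x)) Q := by
  obtain ⟨B, hB⟩ := hQ.exists_bound_of_continuousOn continuous_id.continuousOn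
  set K := ‖T.toContinuousLinearMap‖ with hK
  have hT : ∀ x, ‖T x‖ ≤ K * ‖x‖ := fun x => T.toContinuousLinearMap.le_opNorm x
  have hB' : ∀ x ∈ Q, ‖x‖ ≤ max B 0 := fun x hx => (hB x hx).trans (le_max_left _ _)
  set R := max B 0 with hR
  have hR0 : 0 ≤ R := le_max_right _ _
  refine ⟨K * R ^ 2 + 2 * K * R, by positivity, fun x hx => ?_, fun x hx y hy => ?_⟩
  · have h1 := abs_real_inner_le_norm x (T x)
    have h2 := hB' x hx
    calc |inner ℝ x (T x)| ≤ ‖x‖ * ‖T x‖ := h1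
      _ ≤ R * (K * R) := by
        gcongr
        exact (hT x).trans (by gcongr)
      _ ≤ _ := by
        have : 0 ≤ 2 * K * R := by positivity
        linarith
  · have e : inner ℝ x (T x) - inner ℝ y (T y) = inner ℝ (x - y) (T x) + inner ℝ y (T (x - y)) := by
      simp only [map_sub, inner_sub_left, inner_sub_right]; ring
    have h1 := abs_real_inner_le_norm (x - y) (T x)
    have h2 := abs_real_inner_le_norm y (T (x - y))
    have h3 : ‖x - y‖ * ‖T x‖ ≤ ‖x - y‖ * (K * R) := by
      gcongr; exact (hT x).trans (by gcongr; exact hB' x hx)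
    have h4 : ‖y‖ * ‖T (x - y)‖ ≤ R * (K * ‖x - y‖) := by
      gcongr
      · exact hB' y hy
      · exact hT _
    have h5 : 0 ≤ K * R ^ 2 * ‖x - y‖ := by positivity
    rw [e, Real.norm_eq_abs]
    refine (abs_add_le _ _).trans ?_
    linarith

/-- When x and e are orthonormal this is a great circle, the test curve for subgradients on the
sphere. -/
theorem hasDerivAt_cos_smul_add_sin_smul (x e : E) :
    HasDerivAt (fun t : ℝ => Real.cos t • x + Real.sin t • e) e 0 :=
   (((Real.hasDerivAt_cos 0).smul_const x).add
    ((Real.hasDerivAt_sin 0).smul_const e)).congr_deriv (by simp)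

theorem norm_cos_smul_add_sin_smul {x e : E} (hx : ‖x‖ = 1) (he : ‖e‖ = 1)
    (hxe : inner ℝ x e = 0) (t : ℝ) : ‖Real.cos t • x + Real.sin t • e‖ = 1 := by
  have h : ‖Real.cos t • x + Real.sin t • e‖ ^ 2 = 1 := by
    rw [norm_add_sq_real, norm_smul, norm_smul, hx, he, real_inner_smul_left,
      real_inner_smul_right, hxe]
    simp
  exact (sq_eq_sq₀ (norm_nonneg _) zero_le_one).1 (by rw [h, one_pow])

/-- A Fréchet subgradient of a function that agrees on the unit sphere with a smooth function whose
gradient is tangential is at least as long as that gradient. -/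
theorem norm_gradient_le_of_frechetSubdiff_sphere [CompleteSpace E] {F : E → EReal} {R : E → ℝ}
    {ρ x u : E} (hu : u ∈ frechetSubdiff F x) (hR : HasGradientAt R ρ x) (hx : ‖x‖ = 1)
    (hF : ∀ y, ‖y‖ = 1 → F y = R y) (hxρ : inner ℝ x ρ = 0) : ‖ρ‖ ≤ ‖u‖ := by
  rcases eq_or_ne ρ 0 with rfl | hρ
  · simp
  have hρ0 : 0 < ‖ρ‖ := norm_pos_iff.2 hρ
  have he : ‖‖ρ‖⁻¹ • ρ‖ = 1 := norm_smul_inv_norm hρ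
  have hxe : inner ℝ x (‖ρ‖⁻¹ • ρ) = 0 := by rw [real_inner_smul_right, hxρ, mul_zero]
  have h := inner_eq_of_frechetSubdiff_of_curve hu hR
    (hasDerivAt_cos_smul_add_sin_smul x (‖ρ‖⁻¹ • ρ)) (by simp)
    (Eventually.of_forall fun t => hF _ (norm_cos_smul_add_sin_smul hx he hxe t))
  calc ‖ρ‖ = inner ℝ ρ (‖ρ‖⁻¹ • ρ) := by
        rw [real_inner_smul_right, real_inner_self_eq_norm_sq]; field_simp
    _ = inner ℝ u (‖ρ‖⁻¹ • ρ) := h.symm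
    _ ≤ ‖u‖ * ‖‖ρ‖⁻¹ • ρ‖ := real_inner_le_norm _ _
    _ = ‖u‖ := by rw [he, mul_one]

/-- For the Łojasiewicz inequality at z with value θ, the form of T - θU equals (r - θ)⟨y, Uy⟩ at y,
and (T - θU)y is half of ⟨y, Uy⟩ times the gradient ρ of the quotient, plus (r - θ)Uy. The quotient
is homogeneous of degree 0, so ρ is tangent to the sphere and ‖ρ‖ ≤ ‖u‖. -/
theorem isTameFraction_rayleigh [CompleteSpace E] [FiniteDimensional ℝ E]
    {T U : E →ₗ[ℝ] E} (hT : T.IsSymmetric) (hU : U.IsSymmetric) (hTpos : ∀ x, 0 ≤ inner ℝ x (T x))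
    (hUpos : ∀ x, x ≠ 0 → 0 < inner ℝ x (U x)) {f : E → EReal} {g : E → ℝ}
    (hf : ∀ x, f x = ((inner ℝ x (T x) : ℝ) : EReal) + indicatorTop {y | ‖y‖ = 1} x)
    (hg : ∀ x, g x = inner ℝ x (U x)) :
    IsTameFraction f g univ (fun x => (2 : ℝ) • U x) := by
  obtain rfl : g = fun x => inner ℝ x (U x) := funext hg
  have hf1 : ∀ x, ‖x‖ = 1 → f x = ((inner ℝ x (T x) : ℝ) : EReal) := fun x hx => by
    simp [hf, indicatorTop, hx]
  have hf2 : ∀ x, ‖x‖ ≠ 1 → f x = ⊤ := fun x hx => by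
    simp [hf, indicatorTop, hx]
  have hbot : ∀ x, f x ≠ ⊥ := fun x => by
    by_cases hx : ‖x‖ = 1
    · rw [hf1 x hx]; exact EReal.coe_ne_bot _
    · rw [hf2 x hx]; exact bot_ne_top.symm
  have hD : fracDom f univ = {x | ‖x‖ = 1} := by
    ext x
    by_cases hx : ‖x‖ = 1
    · simp [fracDom, hf1 x hx, hx]
    · simp [fracDom, hf2 x hx, hx]
  have hne : ∀ x : E, ‖x‖ = 1 → x ≠ 0 := fun x hx h => by simp [h] at hx
  have hpos : ∀ x, ‖x‖ = 1 → 0 < inner ℝ x (U x) := fun x hx => hUpos x (hne x hx)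
  have hval : ∀ x, ‖x‖ = 1 → fracValue f (fun x => inner ℝ x (U x)) x
      = inner ℝ x (T x) / inner ℝ x (U x) := fun x hx => by
    rw [fracValue, hf1 x hx, EReal.toReal_coe]
  have hTc : Continuous T := T.continuous_of_finiteDimensional
  have hUc : Continuous U := U.continuous_of_finiteDimensional
  have hgrad : ∀ x, ‖x‖ = 1 → HasGradientAt (fun y => inner ℝ y (T y) / inner ℝ y (U y))
      ((inner ℝ x (U x))⁻¹ • ((2 : ℝ) • T x
        - (inner ℝ x (T x) / inner ℝ x (U x)) • (2 : ℝ) • U x)) x := fun x hx =>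
    (hT.hasGradientAt_inner_self x).fun_div (hU.hasGradientAt_inner_self x) (hpos x hx).ne'
  have hF : ∀ x, ‖x‖ = 1 → fracObjective f (fun x => inner ℝ x (U x)) univ x
      = ((inner ℝ x (T x) / inner ℝ x (U x) : ℝ) : EReal) := fun x hx => by
    rw [fracObjective_eq_coe _ (hbot x) (by rw [hD]; exact hx), hval x hx]
  have hF' : ∀ x, ‖x‖ ≠ 1 → fracObjective f (fun x => inner ℝ x (U x)) univ x = ⊤ := fun x hx => by
    rw [fracObjective_eq_top _ (hbot x) (by rw [hD]; exact hx)]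
  refine ⟨hbot, ?_, ?_, ?_, ?_, ?_, ?_, ?_, ?_, ?_, ?_⟩ <;> try rw [hD]
  · exact isClosed_eq continuous_norm continuous_const
  · intro x hx
    rw [hf1 x hx]; exact hTpos x
  · exact hpos
  · refine LinearMap.convexOn_inner_self fun x => ?_
    rcases eq_or_ne x 0 with rfl | hx
    · simp
    · exact (hUpos x hx).le
  · exact fun x _ => hU.hasGradientAt_inner_self x
  · refine ContinuousOn.congr (f := fun x => inner ℝ x (T x) / inner ℝ x (U x)) ?_ hval
    exact ContinuousOn.div (by fun_prop) (by fun_prop) fun x hx => (hpos x hx).ne'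
  · intro Q hQ hQc
    have h := (isBoundedLipschitzOn_inner_self T hQc).smul
      ((isBoundedLipschitzOn_inner_self U hQc).inv_of_pos hQc fun x hx => hpos x (hQ hx))
    exact h.congr fun x hx => by rw [hval x (hQ hx), div_eq_mul_inv, smul_eq_mul]
  · intro Q _ hQc
    refine isBoundedLipschitzOn_of_lipschitz hQc (C := 2 * ‖U.toContinuousLinearMap‖)
      fun x y => ?_
    rw [← smul_sub, ← map_sub, norm_smul, Real.norm_ofNat, mul_assoc]
    gcongr
    exact U.toContinuousLinearMap.le_opNorm _
  · intro z hz
    refine ⟨_, mem_frechetSubdiff_of_minorant (hgrad z hz) (hF z hz)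
      (Eventually.of_forall fun y => ?_)⟩
    by_cases hy : ‖y‖ = 1
    · rw [hF y hy]
    · rw [hF' y hy]; exact le_top
  · intro z hz
    have hz : ‖z‖ = 1 := hz
    set θ := inner ℝ z (T z) / inner ℝ z (U z) with hθ
    have hM : (T - θ • U).IsSymmetric := fun a b => by
      simp [inner_sub_left, inner_sub_right, real_inner_smul_left, real_inner_smul_right, hT a b,
        hU a b]
    obtain ⟨γ, hγ, hL⟩ := hM.exists_inner_le_norm_sq
    set K := ‖U.toContinuousLinearMap‖ with hK
    have hgz := hpos z hz
    -- On the sphere K bounds both ‖Uy‖ and ⟨y, Uy⟩, hence the coefficients K/2 and K; half of ⟨z,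
    -- Uz⟩ is a lower bound for ⟨y, Uy⟩ near z.
    obtain ⟨γ', η, hγ', hη, hsq⟩ := exists_le_mul_sq_of_mul_le_sq (α := K / 2) (β := K)
      (half_pos hgz) hγ
    refine ⟨γ', η, hη, ?_⟩
    have hcont : Continuous fun y => inner ℝ y (U y) := by fun_prop
    filter_upwards [hcont.continuousAt.eventually (lt_mem_nhds (half_lt_self hgz))] with
      y hgy hy u hu hlt
    have hy : ‖y‖ = 1 := hy
    rw [hval y hy, hval z hz, ← hθ] at hlt ⊢
    set r := inner ℝ y (T y) / inner ℝ y (U y) with hr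
    rcases le_or_gt (r - θ) 0 with hs | hs
    · exact hs.trans (by positivity)
    have hgy0 := hpos y hy
    have hUy : ‖U y‖ ≤ K := by
      have := U.toContinuousLinearMap.le_opNorm y
      rwa [hy, mul_one] at this
    have hgK : inner ℝ y (U y) ≤ K := by
      refine (real_inner_le_norm _ _).trans ?_
      rwa [hy, one_mul]
    have hry : inner ℝ y (T y) = r * inner ℝ y (U y) := by rw [hr]; field_simp
    set ρ := (inner ℝ y (U y))⁻¹ • ((2 : ℝ) • T y - r • (2 : ℝ) • U y) with hρ
    have hρu : ‖ρ‖ ≤ ‖u‖ := by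
      refine norm_gradient_le_of_frechetSubdiff_sphere hu (hgrad y hy) hy hF ?_
      rw [real_inner_smul_right, inner_sub_right, real_inner_smul_right, real_inner_smul_right,
        real_inner_smul_right, hry]
      ring
    have hMy : (T - θ • U) y = (inner ℝ y (U y) / 2) • ρ + (r - θ) • U y := by
      rw [hρ, smul_smul, div_mul_eq_mul_div, mul_inv_cancel₀ hgy0.ne']
      simp only [LinearMap.sub_apply, LinearMap.smul_apply]
      module
    have hMn : ‖(T - θ • U) y‖ ≤ K / 2 * ‖u‖ + (r - θ) * K := by
      rw [hMy]
      refine (norm_add_le _ _).trans ?_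
      rw [norm_smul _ ρ, norm_smul _ (U y), Real.norm_of_nonneg (by positivity),
        Real.norm_of_nonneg hs.le]
      gcongr
    have hq : inner ℝ y ((T - θ • U) y) = (r - θ) * inner ℝ y (U y) := by
      simp only [LinearMap.sub_apply, LinearMap.smul_apply, inner_sub_right,
        real_inner_smul_right, hry]
      ring
    refine hsq (r - θ) ‖u‖ hs.le hlt ?_
    calc (r - θ) * (inner ℝ z (U z) / 2) ≤ (r - θ) * inner ℝ y (U y) := by gcongr
      _ = inner ℝ y ((T - θ • U) y) := hq.symm
      _ ≤ γ * ‖(T - θ • U) y‖ ^ 2 := hL y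
      _ ≤ _ := by gcongr

end Rayleigh

/-! ### The ratio of norms on a polyhedron -/

section SparseRecovery

theorem hasGradientAt_norm {E : Type*} [NormedAddCommGroup E] [InnerProductSpace ℝ E]
    [CompleteSpace E] {x : E} (hx : x ≠ 0) : HasGradientAt (fun y : E => ‖y‖) (‖x‖⁻¹ • x) x := by
  rw [hasGradientAt_iff_hasFDerivAt]
  have hx0 : ‖x‖ ≠ 0 := norm_ne_zero_iff.2 hx
  have h := (hasStrictFDerivAt_norm_sq x).hasFDerivAt.sqrt (pow_ne_zero 2 hx0)
  simp only [Real.sqrt_sq (norm_nonneg _)] at h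
  refine h.congr_fderiv ?_
  ext d
  simp
  field_simp

theorem hasGradientAt_inner_left {E : Type*} [NormedAddCommGroup E] [InnerProductSpace ℝ E]
    [CompleteSpace E] (a x : E) : HasGradientAt (fun y : E => inner ℝ a y) a x := by
  rw [hasGradientAt_iff_hasFDerivAt]
  exact (innerSL ℝ a).hasFDerivAt

theorem eventually_sign_eq {z : ℝ} (hz : z ≠ 0) :
    ∀ᶠ y in 𝓝 z, SignType.sign y = SignType.sign z :=
  (continuousAt_sign_of_ne_zero hz).eventually (p := fun s => s = SignType.sign z)
    (by simp [nhds_discrete])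

variable {N : ℕ}

/-- The vector of signs `σ`. -/
noncomputable def signVector (σ : Fin N → SignType) : EuclideanSpace ℝ (Fin N) :=
  WithLp.toLp 2 fun i => (σ i : ℝ)

theorem inner_signVector (σ : Fin N → SignType) (y : EuclideanSpace ℝ (Fin N)) :
    inner ℝ (signVector σ) y = ∑ i, y i * (σ i : ℝ) := by
  simp [PiLp.inner_apply, signVector]

theorem inner_signVector_eq {σ : Fin N → SignType} {y : EuclideanSpace ℝ (Fin N)}
    (h : ∀ i, y i ≠ 0 → σ i = SignType.sign (y i)) :
    inner ℝ (signVector σ) y = ∑ i, |y i| := by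
  rw [inner_signVector]
  refine Finset.sum_congr rfl fun i _ => ?_
  by_cases hi : y i = 0
  · simp [hi]
  · rw [h i hi, self_mul_sign]

/-- Every sign pattern gives a linear minorant of the ℓ¹ norm; with the signs of z it touches at z
and so yields a subgradient of the objective there. -/
theorem inner_signVector_le (σ : Fin N → SignType) (y : EuclideanSpace ℝ (Fin N)) :
    inner ℝ (signVector σ) y ≤ ∑ i, |y i| := by
  rw [inner_signVector]
  refine Finset.sum_le_sum fun i _ => ?_
  rcases σ i with _ | _ | _
  · simp
  · simpa using neg_le_abs (y i)
  · simpa using le_abs_self (y i)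

theorem sum_abs_pos {y : EuclideanSpace ℝ (Fin N)} (hy : y ≠ 0) : 0 < ∑ i, |y i| := by
  obtain ⟨i, hi⟩ : ∃ i, y i ≠ 0 := by
    by_contra! h
    exact hy (by ext i; simpa using h i)
  exact Finset.sum_pos' (fun _ _ => abs_nonneg _) ⟨i, Finset.mem_univ i, abs_pos.2 hi⟩

theorem isBoundedLipschitzOn_sum_abs {Q : Set (EuclideanSpace ℝ (Fin N))} (hQ : IsCompact Q) :
    IsBoundedLipschitzOn (fun x : EuclideanSpace ℝ (Fin N) => ∑ i, |x i|) Q := by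
  refine isBoundedLipschitzOn_of_lipschitz hQ (C := N) fun x y => ?_
  rw [← Finset.sum_sub_distrib]
  calc ‖∑ i, (|x i| - |y i|)‖ ≤ ∑ i, ‖|x i| - |y i|‖ := norm_sum_le _ _
    _ ≤ ∑ _i : Fin N, ‖x - y‖ := by
      refine Finset.sum_le_sum fun i _ => (abs_abs_sub_abs_le _ _).trans ?_
      simpa using PiLp.norm_apply_le (x - y) i
    _ = _ := by simp

/-- The directions that keep the zero pattern of `σ` and the activity of the constraints in `I`. -/
noncomputable def faceDirection {ι : Type*} (α : ι → EuclideanSpace ℝ (Fin N) →ₗ[ℝ] ℝ)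
    (σ : Fin N → SignType) (I : Set ι) : Submodule ℝ (EuclideanSpace ℝ (Fin N)) where
  carrier := {d | (∀ i, σ i = 0 → d i = 0) ∧ ∀ k ∈ I, α k d = 0}
  add_mem' := fun ha hb => ⟨fun i hi => by simp [ha.1 i hi, hb.1 i hi],
    fun k hk => by simp [ha.2 k hk, hb.2 k hk]⟩
  zero_mem' := by simp
  smul_mem' := fun c _ ha => ⟨fun i hi => by simp [ha.1 i hi],
    fun k hk => by simp [ha.2 k hk]⟩

/-- For y near z, let σ be the signs of y and I its active constraints. Zeros of y are zeros of z
and constraints active at y are active at z, so y - z lies in the face directions; along these the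
objective is the smooth quotient ⟨σ, ·⟩/‖·‖, and squaring it leads to a quadratic form. -/
theorem isTameFraction_sparse {ι : Type*} [Finite ι] {f : EuclideanSpace ℝ (Fin N) → EReal}
    {g : EuclideanSpace ℝ (Fin N) → ℝ} {S : Set (EuclideanSpace ℝ (Fin N))}
    (α : ι → EuclideanSpace ℝ (Fin N) →ₗ[ℝ] ℝ) (b : ι → ℝ)
    (hf : ∀ x, f x = ((∑ i, |x i| : ℝ) : EReal)) (hg : ∀ x, g x = ‖x‖)
    (hS : S = {x | ∀ k, α k x ≤ b k}) (h0 : 0 ∉ S) :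
    IsTameFraction f g S (fun x => ‖x‖⁻¹ • x) := by
  obtain rfl : g = fun x => ‖x‖ := funext hg
  have hbot : ∀ x, f x ≠ ⊥ := fun x => by rw [hf]; exact EReal.coe_ne_bot _
  have hD : fracDom f S = S := by
    ext x
    simp only [fracDom, mem_ofPred_eq, hf]
    exact and_iff_left (EReal.coe_ne_top _)
  have hαc : ∀ k, Continuous (α k) := fun k => (α k).continuous_of_finiteDimensional
  have hSc : IsClosed S := by
    rw [hS, ofPred_forall]
    exact isClosed_iInter fun k => isClosed_le (hαc k) continuous_const
  have hne : ∀ x ∈ S, x ≠ 0 := fun x hx h => h0 (h ▸ hx)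
  have hpos : ∀ x ∈ S, 0 < ‖x‖ := fun x hx => norm_pos_iff.2 (hne x hx)
  have hval : fracValue f (fun x => ‖x‖) = fun x => (∑ i, |x i|) / ‖x‖ := by
    ext x
    rw [fracValue, hf, EReal.toReal_coe]
  have hF : ∀ x ∈ S, fracObjective f (fun x => ‖x‖) S x
      = (((∑ i, |x i|) / ‖x‖ : ℝ) : EReal) := fun x hx => by
    rw [fracObjective_eq_coe _ (hbot x) (by rwa [hD]), hval]
  have hF' : ∀ x ∉ S, fracObjective f (fun x => ‖x‖) S x = ⊤ := fun x hx =>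
    fracObjective_eq_top _ (hbot x) (by rwa [hD])
  have hgrad : ∀ (a x : EuclideanSpace ℝ (Fin N)), x ≠ 0 →
      HasGradientAt (fun y => inner ℝ a y / ‖y‖)
        (‖x‖⁻¹ • (a - (inner ℝ a x / ‖x‖) • (‖x‖⁻¹ • x))) x := fun a x hx =>
    (hasGradientAt_inner_left a x).fun_div (hasGradientAt_norm hx) (norm_ne_zero_iff.2 hx)
  have hnlip : ∀ Q ⊆ S, IsCompact Q →
      IsBoundedLipschitzOn (fun x : EuclideanSpace ℝ (Fin N) => ‖x‖⁻¹) Q := fun Q hQ hQc =>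
    (isBoundedLipschitzOn_of_lipschitz hQc (C := 1) fun x y => by
      rw [one_mul]; exact abs_norm_sub_norm_le x y).inv_of_pos hQc fun x hx => hpos x (hQ hx)
  refine ⟨hbot, ?_, ?_, ?_, ?_, ?_, ?_, ?_, ?_, ?_, ?_⟩ <;> try rw [hD]
  · exact hSc
  · intro x _
    rw [hf, EReal.toReal_coe]
    positivity
  · exact hpos
  · exact convexOn_univ_norm
  · exact fun x hx => hasGradientAt_norm (hne x hx)
  · rw [hval]
    exact ContinuousOn.div (by fun_prop) (by fun_prop) fun x hx => (hpos x hx).ne'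
  · intro Q hQ hQc
    refine ((isBoundedLipschitzOn_sum_abs hQc).smul (hnlip Q hQ hQc)).congr fun x _ => ?_
    simp only [hval, div_eq_mul_inv, smul_eq_mul]
  · intro Q hQ hQc
    exact (hnlip Q hQ hQc).smul
      (isBoundedLipschitzOn_of_lipschitz hQc (C := 1) fun x y => by rw [one_mul])
  · intro z hz
    refine ⟨_, mem_frechetSubdiff_of_minorant
      (hgrad (signVector fun i => SignType.sign (z i)) z (hne z hz)) ?_
      (Eventually.of_forall fun y => ?_)⟩
    · rw [hF z hz, inner_signVector_eq fun _ _ => rfl]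
    · by_cases hy : y ∈ S
      · rw [hF y hy, EReal.coe_le_coe_iff]
        gcongr
        exact inner_signVector_le _ _
      · rw [hF' y hy]; exact le_top
  · intro z hz
    have hzS := hz
    rw [hS] at hzS
    have hz0 := hne z hz
    have hzn := hpos z hz
    set θ := (∑ i, |z i|) / ‖z‖ with hθ
    have hθ0 : 0 < θ := div_pos (sum_abs_pos hz0) hzn
    have hzθ : ∑ i, |z i| = θ * ‖z‖ := by rw [hθ]; field_simp
    set M : (Fin N → SignType) → EuclideanSpace ℝ (Fin N) →ₗ[ℝ] EuclideanSpace ℝ (Fin N) :=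
      fun σ => (innerSL ℝ (signVector σ)).toLinearMap.smulRight (signVector σ)
        - θ ^ 2 • LinearMap.id with hMdef
    have hMa : ∀ σ y, M σ y = (inner ℝ (signVector σ) y : ℝ) • signVector σ - θ ^ 2 • y := by
      intro σ y; simp [hMdef]
    have hM : ∀ σ, (M σ).IsSymmetric := fun σ a c => by
      simp only [hMa, inner_sub_left, inner_sub_right, real_inner_smul_left,
        real_inner_smul_right, real_inner_comm a]
      ring
    have hMq : ∀ σ y, inner ℝ y (M σ y) = (inner ℝ (signVector σ) y) ^ 2 - θ ^ 2 * ‖y‖ ^ 2 := by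
      intro σ y
      rw [hMa, inner_sub_right, real_inner_smul_right, real_inner_smul_right,
        real_inner_self_eq_norm_sq, real_inner_comm y]
      ring
    -- One constant for each pair of a sign pattern and an active set; there are finitely many, so
    -- their sum serves for all. The condition on σ makes z a zero of the form.
    have hex : ∀ j : (Fin N → SignType) × Set ι, ∃ γ : ℝ, 0 ≤ γ ∧ ∀ᶠ y in 𝓝 z,
        inner ℝ (signVector j.1) z = ∑ i, |z i| → y - z ∈ faceDirection α j.1 j.2 → ∀ u,
          (∀ d ∈ faceDirection α j.1 j.2, inner ℝ (M j.1 y) d = inner ℝ u d) →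
            inner ℝ y (M j.1 y) ≤ γ * ‖u‖ ^ 2 := by
      intro j
      by_cases hj : inner ℝ (signVector j.1) z = ∑ i, |z i|
      · obtain ⟨γ, hγ, h⟩ := (hM j.1).eventually_inner_le_norm_sq (faceDirection α j.1 j.2) (p := z)
          (by rw [hMq, hj, hzθ]; ring)
        exact ⟨γ, hγ, h.mono fun y hy _ => hy⟩
      · exact ⟨0, le_rfl, Eventually.of_forall fun y h => absurd h hj⟩
    choose γ hγ0 hγ using hex
    have : Fintype ((Fin N → SignType) × Set ι) := Fintype.ofFinite _
    set Γ := ∑ j, γ j with hΓ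
    have hΓ0 : 0 ≤ Γ := Finset.sum_nonneg fun j _ => hγ0 j
    have hγΓ : ∀ j, γ j ≤ Γ := fun j =>
      Finset.single_le_sum (fun j _ => hγ0 j) (Finset.mem_univ j)
    -- Near z one has ‖z‖/2 < ‖y‖ < 2‖z‖, and r ≤ θ + 1; these bound the coefficient r‖y‖² of u, the
    -- norm ‖y‖, and the factor ‖y‖² from below.
    obtain ⟨γ', η, hγ', hη, hsq⟩ := exists_le_mul_sq_of_mul_le_sq
      (α := (θ + 1) * (2 * ‖z‖) ^ 2) (β := 2 * ‖z‖) (q := (‖z‖ / 2) ^ 2) (by positivity) hΓ0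
    -- For 0 < r - θ < 1 one has (r - θ)θ ≤ r² - θ² ≤ (r - θ)(2θ + 1), which converts a bound on r²
    -- - θ² into one on r - θ.
    refine ⟨γ' / θ, min 1 (η / (2 * θ + 1)), lt_min one_pos (by positivity), ?_⟩
    have hcoord : ∀ i, Tendsto (fun y : EuclideanSpace ℝ (Fin N) => y i) (𝓝 z) (𝓝 (z i)) :=
      fun i => (by fun_prop : Continuous fun y : EuclideanSpace ℝ (Fin N) => y i).tendsto z
    have esign : ∀ᶠ y : EuclideanSpace ℝ (Fin N) in 𝓝 z, ∀ i, z i ≠ 0 →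
        SignType.sign (y i) = SignType.sign (z i) := by
      refine eventually_all.2 fun i => ?_
      by_cases hi : z i = 0
      · exact Eventually.of_forall fun y h => absurd hi h
      · exact ((hcoord i).eventually (eventually_sign_eq hi)).mono fun y hy _ => hy
    have eact : ∀ᶠ y in 𝓝 z, ∀ k, α k y = b k → α k z = b k := by
      refine eventually_all.2 fun k => ?_
      rcases (hzS k).eq_or_lt with hk | hk
      · exact Eventually.of_forall fun y _ => hk
      · exact ((hαc k).continuousAt.eventually (gt_mem_nhds hk)).mono
          fun y hy h => absurd h hy.ne
    have enorm1 : ∀ᶠ y in 𝓝 z, ‖z‖ / 2 < ‖y‖ :=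
      continuous_norm.continuousAt.eventually (lt_mem_nhds (half_lt_self hzn))
    have enorm2 : ∀ᶠ y in 𝓝 z, ‖y‖ < 2 * ‖z‖ :=
      continuous_norm.continuousAt.eventually (gt_mem_nhds (by linarith))
    filter_upwards [esign, eact, enorm1, enorm2, eventually_all.2 hγ] with
      y hsign hact hn1 hn2 hloj hyS u hu hlt
    rw [hval] at hlt ⊢
    simp only at hlt ⊢
    rw [← hθ] at hlt ⊢
    set r := (∑ i, |y i|) / ‖y‖ with hr
    rcases le_or_gt (r - θ) 0 with hs | hs
    · exact hs.trans (by positivity)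
    have hlt1 : r - θ < 1 := hlt.trans_le (min_le_left _ _)
    have hlt2 : (r - θ) * (2 * θ + 1) < η := by
      rw [← lt_div_iff₀ (by positivity)]
      exact hlt.trans_le (min_le_right _ _)
    have hyn := hpos y hyS
    have hyr : ∑ i, |y i| = r * ‖y‖ := by rw [hr]; field_simp
    set σ : Fin N → SignType := fun i => SignType.sign (y i) with hσ
    set I : Set ι := {k | α k y = b k} with hI
    have hσy : inner ℝ (signVector σ) y = r * ‖y‖ := by
      rw [inner_signVector_eq fun _ _ => rfl, hyr]
    have hyS' := hyS
    rw [hS] at hyS'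
    -- For small t of either sign, y + td keeps the zeros, the nonzero signs, the active constraints
    -- and the strict inequalities of y, so u acts on d as the gradient of the smooth quotient.
    have hdir : ∀ d ∈ faceDirection α σ I, inner ℝ u d
        = inner ℝ (‖y‖⁻¹ • (signVector σ - (inner ℝ (signVector σ) y / ‖y‖) • (‖y‖⁻¹ • y))) d := by
      rintro d ⟨hd1, hd2⟩
      have hline : Continuous fun t : ℝ => y + t • d := by fun_prop
      refine inner_eq_of_frechetSubdiff_of_curve (z := fun t => y + t • d) hu
        (hgrad _ y (hne y hyS)) ?_ (by simp) ?_
      · simpa using ((hasDerivAt_id (0 : ℝ)).smul_const d).const_add y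
      · have e1 : ∀ᶠ t : ℝ in 𝓝 0, ∀ k, α k (y + t • d) ≤ b k := by
          refine eventually_all.2 fun k => ?_
          rcases (hyS' k).eq_or_lt with hk | hk
          · refine Eventually.of_forall fun t => ?_
            simp [hd2 k hk, hk]
          · have hc : ContinuousAt (fun t : ℝ => α k (y + t • d)) 0 :=
              ((hαc k).comp hline).continuousAt
            exact (hc.eventually (gt_mem_nhds (by simpa using hk))).mono fun t ht => ht.le
        have e2 : ∀ᶠ t : ℝ in 𝓝 0, ∀ i, (y + t • d) i ≠ 0 →
            σ i = SignType.sign ((y + t • d) i) := by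
          refine eventually_all.2 fun i => ?_
          by_cases hi : y i = 0
          · refine Eventually.of_forall fun t ht => absurd ?_ ht
            simp [hi, hd1 i (by simp [hσ, hi])]
          · have hc : Tendsto (fun t : ℝ => (y + t • d) i) (𝓝 0) (𝓝 (y i)) := by
              have : Continuous fun t : ℝ => (y + t • d) i := by fun_prop
              simpa using this.tendsto 0
            exact (hc.eventually (eventually_sign_eq hi)).mono fun t ht _ => ht.symm
        filter_upwards [e1, e2] with t h1 h2
        rw [hF _ (by rw [hS]; exact h1), inner_signVector_eq h2]
    -- With ρ the gradient of the smooth quotient, My = r‖y‖²ρ + (r² - θ²)y. Replacing ρ by u does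
    -- not change inner products with face directions.
    have hL := hloj (σ, I) (inner_signVector_eq fun i hi => hsign i hi)
      ⟨fun i hi => ?_, fun k hk => ?_⟩ ((r * ‖y‖ ^ 2) • u + (r ^ 2 - θ ^ 2) • y) ?_
    rotate_left
    · have hyi : y i = 0 := by simpa [hσ] using hi
      by_contra h
      have hzi : z i ≠ 0 := fun hzi => h (by simp [hyi, hzi])
      have := hsign i hzi
      rw [hyi, sign_zero, eq_comm, sign_eq_zero_iff] at this
      exact hzi this
    · have hk : α k y = b k := hk
      rw [map_sub, hk, hact k hk, sub_self]
    · intro d hd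
      have h1 := hdir d hd
      rw [hσy, real_inner_smul_left, inner_sub_left, real_inner_smul_left,
        real_inner_smul_left] at h1
      rw [hMa, hσy, inner_sub_left, inner_add_left, real_inner_smul_left, real_inner_smul_left,
        real_inner_smul_left, real_inner_smul_left, h1]
      field_simp
      ring
    have hr0 : 0 < r := by linarith
    have hs2 : 0 < r ^ 2 - θ ^ 2 := by nlinarith
    have hs3 : r ^ 2 - θ ^ 2 ≤ (r - θ) * (2 * θ + 1) := by nlinarith
    have hs4 : (r - θ) * θ ≤ r ^ 2 - θ ^ 2 := by nlinarith
    simp only at hL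
    rw [hMq, hσy] at hL
    have hnorm : ‖(r * ‖y‖ ^ 2) • u + (r ^ 2 - θ ^ 2) • y‖
        ≤ (θ + 1) * (2 * ‖z‖) ^ 2 * ‖u‖ + (r ^ 2 - θ ^ 2) * (2 * ‖z‖) := by
      refine (norm_add_le _ _).trans ?_
      rw [norm_smul, norm_smul, Real.norm_of_nonneg (by positivity), Real.norm_of_nonneg hs2.le]
      have : r ≤ θ + 1 := by linarith
      gcongr
    have hfin := hsq (r ^ 2 - θ ^ 2) ‖u‖ hs2.le (hs3.trans_lt hlt2) (by
      calc (r ^ 2 - θ ^ 2) * (‖z‖ / 2) ^ 2 ≤ (r ^ 2 - θ ^ 2) * ‖y‖ ^ 2 := by gcongr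
        _ = (r * ‖y‖) ^ 2 - θ ^ 2 * ‖y‖ ^ 2 := by ring
        _ ≤ γ (σ, I) * ‖(r * ‖y‖ ^ 2) • u + (r ^ 2 - θ ^ 2) • y‖ ^ 2 := hL
        _ ≤ _ := by
          gcongr
          exact hγΓ _)
    rw [div_mul_eq_mul_div, le_div_iff₀ hθ0]
    exact hs4.trans hfin

end SparseRecovery

/-! ### The two problems are tame -/

section Problems

variable {N : ℕ} {f : EuclideanSpace ℝ (Fin N) → EReal} {g : EuclideanSpace ℝ (Fin N) → ℝ}
  {S : Set (EuclideanSpace ℝ (Fin N))}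

theorem quadForm_eq_inner (A : Matrix (Fin N) (Fin N) ℝ) (x : EuclideanSpace ℝ (Fin N)) :
    quadForm A x = inner ℝ x (A.toEuclideanLin x) := by
  simp only [quadForm, PiLp.inner_apply, Matrix.ofLp_toLpLin, Matrix.toLin'_apply, dotProduct]
  refine Finset.sum_congr rfl fun i _ => ?_
  simp [mul_comm]

theorem quadForm_pos {A : Matrix (Fin N) (Fin N) ℝ} (hA : A.PosDef)
    {x : EuclideanSpace ℝ (Fin N)} (hx : x ≠ 0) : 0 < quadForm A x := by
  have h : x.ofLp ≠ 0 := fun h => hx (by ext i; simp [h])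
  simpa [quadForm] using hA.dotProduct_mulVec_pos h

theorem IsRayleighProblem.exists_isTameFraction (h : IsRayleighProblem f g S) :
    ∃ G, IsTameFraction f g S G := by
  obtain ⟨A, B, hA, hB, hf, hg, rfl⟩ := h
  refine ⟨_, isTameFraction_rayleigh (T := A.toEuclideanLin) (U := B.toEuclideanLin)
    (Matrix.isSymmetric_toEuclideanLin_iff.2 hA.isHermitian)
    (Matrix.isSymmetric_toEuclideanLin_iff.2 hB.isHermitian) (fun x => ?_) (fun x hx => ?_)
    (fun x => ?_) (fun x => ?_)⟩
  · rw [← quadForm_eq_inner]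
    rcases eq_or_ne x 0 with rfl | hx
    · simp [quadForm]
    · exact (quadForm_pos hA hx).le
  · rw [← quadForm_eq_inner]; exact quadForm_pos hB hx
  · rw [hf, quadForm_eq_inner]
  · rw [hg, quadForm_eq_inner]

theorem IsSparseRecoveryProblem.exists_isTameFraction (h : IsSparseRecoveryProblem f g S) :
    ∃ G, IsTameFraction f g S G := by
  obtain ⟨K, P, A, b, C, d, hf, hg, hS, h0⟩ := h
  let row {m : ℕ} (B : Matrix (Fin m) (Fin N) ℝ) (i : Fin m) :
      EuclideanSpace ℝ (Fin N) →ₗ[ℝ] ℝ :=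
    LinearMap.proj i ∘ₗ B.mulVecLin ∘ₗ (WithLp.linearEquiv 2 ℝ (Fin N → ℝ)).toLinearMap
  have hrow : ∀ {m : ℕ} (B : Matrix (Fin m) (Fin N) ℝ) (i : Fin m) x,
      row B i x = (B *ᵥ x.ofLp) i := fun B i x => rfl
  -- The equation Cx = d is split into Cx ≤ d and -Cx ≤ -d, so that only inequality constraints
  -- remain.
  refine ⟨_, isTameFraction_sparse
    (Sum.elim (row A) (Sum.elim (row C) fun i => -row C i))
    (Sum.elim b (Sum.elim d fun i => -d i)) hf hg ?_ h0⟩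
  rw [hS]
  ext x
  simp only [mem_ofPred_eq, Sum.forall, Sum.elim_inl, Sum.elim_inr, LinearMap.neg_apply, hrow,
    neg_le_neg_iff, funext_iff]
  refine and_congr_right fun _ => ⟨fun h => ⟨fun i => (h i).le, fun i => (h i).ge⟩,
    fun h i => le_antisymm (h.1 i) (h.2 i)⟩

end Problems

theorem proposition5p7 {N : ℕ} (f : EuclideanSpace ℝ (Fin N) → EReal)
    (g : EuclideanSpace ℝ (Fin N) → ℝ) (S : Set (EuclideanSpace ℝ (Fin N)))
    (hcase : IsRayleighProblem f g S ∨ IsSparseRecoveryProblem f g S) :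
    (∀ c : ℝ, 0 ≤ c → ∀ x ∈ S, f x ≠ ⊤ →
      HasKLExponentAt (meritFunction f g S c) (WithLp.toLp 2 (x, x)) (1 / 2)) ∧
    (∀ (fs : EuclideanSpace ℝ (Fin N) → ℝ) (fn : EuclideanSpace ℝ (Fin N) → EReal)
      (p : EPSGParams) (x w : ℕ → EuclideanSpace ℝ (Fin N)) (τ κ μ : ℕ → ℝ),
      IsNumeratorSplitting f fs fn p.ℓ → p.Admissible f g S →
      IsEPSGSequence f fs fn g S p x w τ κ μ →
      Bornology.IsBounded {y | y ∈ S ∧ fracQuotient f g y ≤ fracQuotient f g (x 0)} →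
      0 < liminf τ atTop →
      ∃ xlim, IsStationaryPoint f g S xlim ∧ f xlim ≠ ⊤ ∧
        ∃ γ₁ γ₂ ρ : ℝ, 0 < γ₁ ∧ 0 < γ₂ ∧ 0 < ρ ∧ ρ < 1 ∧ ∀ n : ℕ,
          x n ∈ S ∧ f (x n) ≠ ⊤ ∧
          |(meritFunction f g S p.meritConst (WithLp.toLp 2 (x (n + 1), x n))).toReal
            - (meritFunction f g S p.meritConst (WithLp.toLp 2 (xlim, xlim))).toReal| ≤
              γ₁ * ρ ^ n ∧
          ‖x n - xlim‖ ≤ γ₂ * ρ ^ ((n : ℝ) / 2)) := by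
  obtain ⟨G, hG⟩ : ∃ G, IsTameFraction f g S G :=
    hcase.elim IsRayleighProblem.exists_isTameFraction
      IsSparseRecoveryProblem.exists_isTameFraction
  exact ⟨fun c hc x hxS hfx => hG.hasKLExponentAt hc ⟨hxS, hfx⟩,
    fun fs fn p x w τ κ μ hs hp hx hbdd hτ => hx.exists_linear_rate hG hs hp hbdd hτ⟩
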